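/- Let $\tau\in\mathbb{C}$ with $\operatorname{Im}\tau>0$, put $q=e^{\pi i\tau}$ (so $0<|q|<1$), $\log q=\pi i\tau$ and $q^{z}=e^{\pi i\tau z}$ for $z\in\mathbb{C}$; a function written with base $q^{r}$ ($r>0$) is obtained by replacing $\tau$ by $r\tau$. Write $(a;q)_\infty=\prod_{i\ge 0}(1-aq^{i})$ and $$\Gamma_q(z)=\frac{(q;q)_\infty}{(q^{z};q)_\infty}(1-q)^{1-z},\qquad \psi_q(z)=\frac{\Gamma_q'(z)}{\Gamma_q(z)},$$ $$\sin_q(\pi z)=q^{1/4}\,\Gamma_{q^2}\!\left(\tfrac12\right)^{2}\frac{q^{z(z-1)}}{\Gamma_{q^2}(z)\,\Gamma_{q^2}(1-z)},\qquad \mathrm{Ct}_q(z)=\frac{\sin_q'(z)}{\sin_q(z)},\qquad \Pi_q=q^{1/4}\frac{(q^2;q^2)_\infty^2}{(q;q^2)_\infty^2},$$ where $(1-q)^{1-z}$ is the principal power, and let $\Pi_q^{1/2}=q^{1/8}\,(q^2;q^2)_\infty/(q;q^2)_\infty$ (the branch that is positive for $0<q<1$) and $\Pi_q^{3/2}=(\Pi_q^{1/2})^3$.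 Let $M$ be a positive integer and let $a$ be an odd integer. Then: (a) $$\sum_{k=1}^{M}\Big(\psi_q\big(\tfrac{2k+a}{2M}\big)-\psi_q\big(1-\tfrac{2k+a}{2M}\big)\Big)=\frac{a+1}{2}\log q.$$ (b) $$\sum_{k=1}^{M}\Big(\psi_q\big(\tfrac{4k+a}{4M}\big)-\psi_q\big(1-\tfrac{4k+a}{4M}\big)\Big)=\frac{(a+2)\log q}{4}-M\pi\,\mathrm{Ct}_{q^{1/(2M)}}\big(\tfrac{a\pi}{4}\big),$$ and this equals $$\frac{(a+2)\log q}{4}+\frac{\log q}{4}\,\frac{\Pi_{q^{1/(4M)}}^{2}}{\Pi_{q^{1/(2M)}}}\quad\text{if } a\equiv 1,-3 \pmod 8,$$ $$\frac{(a+2)\log q}{4}-\frac{\log q}{4}\,\frac{\Pi_{q^{1/(4M)}}^{2}}{\Pi_{q^{1/(2M)}}}\quad\text{if } a\equiv -1,3 \pmod 8.$$ (c) $$\sum_{k=1}^{M}\Big(\psi_q\big(\tfrac{6k+a}{6M}\big)-\psi_q\big(1-\tfrac{6k+a}{6M}\big)\Big)=\frac{(a+3)\log q}{6}-M\pi\,\mathrm{Ct}_{q^{1/(2M)}}\big(\tfrac{a\pi}{6}\big),$$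 and this equals $$\frac{(a+3)\log q}{6}+\frac{\log q}{3}\,\frac{\Pi_{q^{1/(6M)}}^{3/2}}{\Pi_{q^{1/(2M)}}^{1/2}}\quad\text{if } a\equiv 1,-5 \pmod{12},$$ $$\frac{(a+3)\log q}{6}-\frac{\log q}{3}\,\frac{\Pi_{q^{1/(6M)}}^{3/2}}{\Pi_{q^{1/(2M)}}^{1/2}}\quad\text{if } a\equiv -1,5 \pmod{12}.$$ -/

import Mathlib

noncomputable section

namespace GosperTrig

/-! Throughout, the base is `q = exp (π i τ)` with `0 < Im τ`, so that `0 < |q| < 1`.  Every function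
of `q` is written as a function of `τ`; the base `q ^ r` (`r` real) corresponds to `r * τ`. -/

/-- `log q = π i τ`. -/
def logq (τ : ℂ) : ℂ := (Real.pi : ℂ) * Complex.I * τ

/-- `q ^ z = exp (z log q)` for complex `z`. -/
def qpow (τ z : ℂ) : ℂ := Complex.exp (z * logq τ)

/-- The base `q` itself. -/
def nome (τ : ℂ) : ℂ := Complex.exp (logq τ)

/-- The infinite `q`-shifted factorial `(a; q)_∞ = ∏_{i ≥ 0} (1 - a q ^ i)`. -/
def qPochInf (a q : ℂ) : ℂ := ∏' i : ℕ, (1 - a * q ^ i)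

/-- For `|q| < 1` the infinite `q`-shifted factorial is the limit of the finite ones. -/
theorem tendsto_qPochInf (a q : ℂ) (hq : ‖q‖ < 1) :
    Filter.Tendsto (fun n : ℕ => ∏ i ∈ Finset.range n, (1 - a * q ^ i)) Filter.atTop
      (nhds (qPochInf a q)) := by
  have hs : Summable fun i : ℕ => ‖-(a * q ^ i)‖ := by
    simp only [norm_neg, norm_mul, norm_pow]
    exact (summable_geometric_of_lt_one (norm_nonneg q) hq).mul_left _
  have hm : Multipliable fun i : ℕ => (1 - a * q ^ i) := by
    simpa only [sub_eq_add_neg] using multipliable_one_add_of_summable hs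
  exact hm.hasProd.tendsto_prod_nat

/-- The `q`-gamma function `Γ_q(z) = (q; q)_∞ / (q ^ z; q)_∞ * (1 - q) ^ (1 - z)`. -/
def qGamma (τ z : ℂ) : ℂ :=
  qPochInf (nome τ) (nome τ) / qPochInf (qpow τ z) (nome τ) * (1 - nome τ) ^ (1 - z)

/-- The `q`-digamma function `ψ_q(z) = Γ_q'(z) / Γ_q(z)`. -/
def qDigamma (τ z : ℂ) : ℂ := deriv (qGamma τ) z / qGamma τ z

/-- Gosper's `q`-sine:
`sin_q (π z) = q ^ (1/4) Γ_{q²}(1/2)² q ^ (z (z - 1)) / (Γ_{q²}(z) Γ_{q²}(1 - z))`,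
written in the variable `w = π z`. At the poles of the two gamma factors
Lean's `x / 0 = 0` gives the correct value `0`. -/
def qSin (τ w : ℂ) : ℂ :=
  let z : ℂ := w / (Real.pi : ℂ)
  qpow τ (1 / 4) * qGamma (2 * τ) (1 / 2) ^ 2 * qpow τ (z * (z - 1)) /
    (qGamma (2 * τ) z * qGamma (2 * τ) (1 - z))

/-- The `q`-cotangent `Ct_q(w) = sin_q'(w) / sin_q(w)`, the derivative being taken in `w`. -/
def qCot (τ w : ℂ) : ℂ := deriv (qSin τ) w / qSin τ w

/-- Gosper's constant `Π_q = q ^ (1/4) (q²; q²)_∞² / (q; q²)_∞²`. -/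
def gosperPi (τ : ℂ) : ℂ :=
  qpow τ (1 / 4) * qPochInf (nome τ ^ 2) (nome τ ^ 2) ^ 2 / qPochInf (nome τ) (nome τ ^ 2) ^ 2

/-- The square root `Π_q ^ (1/2) = q ^ (1/8) (q²; q²)_∞ / (q; q²)_∞`: the branch that is
holomorphic on `0 < Im τ` and positive for `0 < q < 1`. -/
def gosperPiSqrt (τ : ℂ) : ℂ :=
  qpow τ (1 / 8) * qPochInf (nome τ ^ 2) (nome τ ^ 2) / qPochInf (nome τ) (nome τ ^ 2)

theorem gosperPiSqrt_sq (τ : ℂ) : gosperPiSqrt τ ^ 2 = gosperPi τ := by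
  have h : qpow τ (1 / 8) ^ 2 = qpow τ (1 / 4) := by
    unfold qpow
    rw [← Complex.exp_nat_mul]
    congr 1
    push_cast
    ring
  unfold gosperPiSqrt gosperPi
  rw [div_pow, mul_pow, h]

theorem qPochInf_pos (a r : ℝ) (ha : a < 1) (ha0 : 0 ≤ a) (hr0 : 0 ≤ r) (hr : r < 1) :
    ∃ p : ℝ, 0 < p ∧ qPochInf (a : ℂ) (r : ℂ) = (p : ℂ) := by
  have hs : Summable fun i : ℕ => -(a * r ^ i) :=
    ((summable_geometric_of_lt_one hr0 hr).mul_left a).neg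
  have hpos : ∀ i : ℕ, 0 < 1 + -(a * r ^ i) := by
    intro i
    have h1 : r ^ i ≤ 1 := pow_le_one₀ hr0 hr.le
    have h2 : a * r ^ i ≤ a * 1 := mul_le_mul_of_nonneg_left h1 ha0
    linarith
  have hl := Real.summable_log_one_add_of_summable hs
  have hp : HasProd (fun i : ℕ => 1 + -(a * r ^ i))
      (Real.exp (∑' i : ℕ, Real.log (1 + -(a * r ^ i)))) := by
    have := hl.hasSum.rexp
    refine this.congr_fun ?_
    intro i
    simp [Real.exp_log (hpos i)]
  refine ⟨Real.exp (∑' i : ℕ, Real.log (1 + -(a * r ^ i))), Real.exp_pos _, ?_⟩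
  have hc := hp.map Complex.ofRealHom Complex.continuous_ofReal
  unfold qPochInf
  rw [← Complex.ofRealHom_eq_coe (Real.exp _), ← hc.tprod_eq]
  refine tprod_congr fun i => ?_
  simp [sub_eq_add_neg]

/-- For `0 < q < 1`, that is `τ = i t` with `t > 0`, `gosperPiSqrt` is the positive root. -/
theorem gosperPiSqrt_pos (t : ℝ) (ht : 0 < t) :
    ∃ p : ℝ, 0 < p ∧ gosperPiSqrt (t * Complex.I) = (p : ℂ) := by
  have hl : logq (t * Complex.I) = ((-(Real.pi * t) : ℝ) : ℂ) := by
    unfold logq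
    push_cast
    linear_combination (Real.pi : ℂ) * t * Complex.I_mul_I
  have hn : nome (t * Complex.I) = ((Real.exp (-(Real.pi * t)) : ℝ) : ℂ) := by
    unfold nome
    rw [hl, Complex.ofReal_exp]
  have hx0 : 0 < Real.exp (-(Real.pi * t)) := Real.exp_pos _
  have hx1 : Real.exp (-(Real.pi * t)) < 1 := by
    rw [Real.exp_lt_one_iff]
    have := mul_pos Real.pi_pos ht
    linarith
  have hx2 : Real.exp (-(Real.pi * t)) ^ 2 < 1 := pow_lt_one₀ hx0.le hx1 two_ne_zero
  obtain ⟨u, hu, hu'⟩ := qPochInf_pos _ _ hx2 (sq_nonneg _) (sq_nonneg _) hx2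
  obtain ⟨v, hv, hv'⟩ := qPochInf_pos _ _ hx1 hx0.le (sq_nonneg _) hx2
  refine ⟨Real.exp (1 / 8 * -(Real.pi * t)) * u / v, by positivity, ?_⟩
  unfold gosperPiSqrt qpow
  rw [hn, hl]
  push_cast at hu' hv' ⊢
  rw [hu', hv']

end GosperTrig

end

/-!
With `L(x) = q^x / (1 - q^x)`, logarithmic differentiation of the product for `Γ_q` gives
`ψ_q(z) = -log (1 - q) + log q * ∑_{i ≥ 0} L(z + i)` (`qDigamma_eq`), so `ψ_q(z) - ψ_q(1 - z)` is
`log q` times an antisymmetrised Lambert series.  Subtracting `z - 1/2` from that series gives the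
function `lambertCot`, which has period one because `L(x) + L(-x) = -1`, changes sign under
`z ↦ 1 - z`, and is up to a factor `-2 log q` the logarithmic derivative of the `q`-sine whose gamma
factors have base `q²` (`qCot_eq`).

As `k` runs over `1, …, M` and `i` over the naturals, `k - 1 + M i` runs once over the naturals, so
the sum over the points `(k + b) / M` is the same Lambert series at `b + 1` in base `q^{1/M}`
(`sum_qDigamma_sub`).  This yields the cotangent forms, and, since `lambertCot` vanishes at `1/2`,
the evaluation for `b = a/2`.  For `b = a/4` and `b = a/6`, periodicity and oddness reduce everything
to the values at `1/4` and `1/6`.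

In terms of `p = q^{1/4}` and `p = q^{1/6}` (`q` being the base of `lambertCot`), these two values
are classical Lambert series, whose product forms come from the bilateral identity
`∑_{k ∈ ℤ} p^k / (1 - y p^{2k})
  = (yp; p²)_∞ (p/y; p²)_∞ (p²; p²)_∞² / ((y; p²)_∞ (p²/y; p²)_∞ (p; p²)_∞²)`
(`tsum_zpow_div`) at `y = -1` and at `y` a primitive cube root of unity.  The bilateral identity is
the limit of the partial fraction expansion of the rational function
`(yp; p²)_N (p/y; p²)_N / ((y; p²)_{N+1} (p²/y; p²)_N)`, whose coefficients are explicit, by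
dominated convergence.
-/

namespace GosperTrig

open Filter Topology

/-! ### Finite partial fractions -/

/-- The finite `q`-shifted factorial `(a; q)_n`. -/
def qPoch (a q : ℂ) (n : ℕ) : ℂ := ∏ i ∈ Finset.range n, (1 - a * q ^ i)

theorem one_sub_pow_ne_zero {p : ℂ} (hp : ‖p‖ < 1) {n : ℕ} (hn : n ≠ 0) : 1 - p ^ n ≠ 0 := by
  intro h
  have h1 : ‖p ^ n‖ = 1 := by rw [← sub_eq_zero.mp h, norm_one]
  rw [norm_pow] at h1
  exact (pow_lt_one₀ (norm_nonneg p) hp hn).ne h1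

theorem qPoch_sq_ne_zero {p : ℂ} (hp : ‖p‖ < 1) (n : ℕ) : qPoch (p ^ 2) (p ^ 2) n ≠ 0 := by
  refine Finset.prod_ne_zero_iff.mpr fun i _ => ?_
  rw [show p ^ 2 * (p ^ 2) ^ i = p ^ (2 * i + 2) by ring]
  exact one_sub_pow_ne_zero hp (by omega)

/-- The ratio `c_n = (p; p²)_n / (p²; p²)_n`.  The coefficient of `1 / (1 - z p^{2j})` in the partial
fraction expansion of `(z p; p²)_n / (z; p²)_{n+1}` is `p^j c_j c_{n-j}`. -/
noncomputable def pochRatio (p : ℂ) (n : ℕ) : ℂ := qPoch p (p ^ 2) n / qPoch (p ^ 2) (p ^ 2) n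

/-- Reversing a product of factors with negative exponents: for every `y ≠ 0`,
`∏ (1 - y p^{-(2l+1)}) / (1 - y p^{-(2l+2)})` over `l < n` is
`p^n (p / y; p²)_n / (p² / y; p²)_n`. -/
theorem prod_one_sub_inv_pow {p y : ℂ} (hp0 : p ≠ 0) (hy : y ≠ 0) (n : ℕ) :
    (∏ l ∈ Finset.range n, (1 - y * p⁻¹ ^ (2 * l + 1))) * qPoch (p ^ 2 / y) (p ^ 2) n =
      p ^ n * qPoch (p / y) (p ^ 2) n *
        ∏ l ∈ Finset.range n, (1 - y * p⁻¹ ^ (2 * l + 2)) := by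
  unfold qPoch
  rw [← Finset.card_range n, ← Finset.prod_const, Finset.card_range, ← Finset.prod_mul_distrib,
    ← Finset.prod_mul_distrib, ← Finset.prod_mul_distrib]
  refine Finset.prod_congr rfl fun l _ => ?_
  rw [inv_pow, inv_pow]
  field_simp
  ring

/-- The value of the numerator of the partial fraction expansion at its pole `p^{-2j}`. -/
theorem prod_at_node {p : ℂ} (hp0 : p ≠ 0) (hp : ‖p‖ < 1) (j m : ℕ) :
    ∏ i ∈ Finset.range (j + m), (1 - p⁻¹ ^ (2 * j) * p ^ (2 * i + 1)) =
      p ^ j * pochRatio p j * pochRatio p m *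
        ∏ i ∈ (Finset.range (j + m + 1)).erase j, (1 - p⁻¹ ^ (2 * j) * p ^ (2 * i)) := by
  have h1 : ∏ i ∈ Finset.range (j + m), (1 - p⁻¹ ^ (2 * j) * p ^ (2 * i + 1)) =
      (∏ l ∈ Finset.range j, (1 - 1 * p⁻¹ ^ (2 * l + 1))) * qPoch p (p ^ 2) m := by
    rw [Finset.prod_range_add, ← Finset.prod_range_reflect]
    unfold qPoch
    congr 1
    · refine Finset.prod_congr rfl fun i hi => ?_
      obtain ⟨d, rfl⟩ : ∃ d, j = i + 1 + d :=
        ⟨j - (i + 1), by have := Finset.mem_range.mp hi; omega⟩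
      rw [show i + 1 + d - 1 - i = d by omega, inv_pow, inv_pow]
      field_simp
      ring
    · refine Finset.prod_congr rfl fun i hi => ?_
      rw [inv_pow]
      field_simp
      ring
  have h2 : ∏ i ∈ (Finset.range (j + m + 1)).erase j, (1 - p⁻¹ ^ (2 * j) * p ^ (2 * i)) =
      (∏ l ∈ Finset.range j, (1 - 1 * p⁻¹ ^ (2 * l + 2))) * qPoch (p ^ 2) (p ^ 2) m := by
    have h3 : (Finset.range (j + m + 1)).erase j =
        (Finset.range (j + (m + 1))).filter (fun i => i ≠ j) := by
      ext i; simp [and_comm, add_assoc]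
    rw [h3, Finset.prod_filter, Finset.prod_range_add, Finset.prod_range_succ',
      ← Finset.prod_range_reflect]
    unfold qPoch
    simp only [add_zero, ne_eq, not_true_eq_false, if_false, mul_one]
    congr 1
    · refine Finset.prod_congr rfl fun i hi => ?_
      obtain ⟨d, rfl⟩ : ∃ d, j = i + 1 + d :=
        ⟨j - (i + 1), by have := Finset.mem_range.mp hi; omega⟩
      rw [show i + 1 + d - 1 - i = d by omega, if_pos (by omega), inv_pow, inv_pow]
      field_simp
      ring
    · refine Finset.prod_congr rfl fun i hi => ?_
      rw [if_pos (by omega), inv_pow]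
      field_simp
      ring
  have h4 := prod_one_sub_inv_pow hp0 one_ne_zero j
  rw [div_one, div_one] at h4
  rw [h1, h2]
  unfold pochRatio
  have := qPoch_sq_ne_zero hp j
  have := qPoch_sq_ne_zero hp m
  rw [mul_div_assoc', mul_div_assoc', div_mul_eq_mul_div, div_mul_eq_mul_div, div_mul_eq_mul_div,
    eq_div_iff ‹_›, eq_div_iff ‹_›]
  linear_combination qPoch p (p ^ 2) m * qPoch (p ^ 2) (p ^ 2) m * h4

/-- Partial fraction expansion of `(z p; p²)_n / (z; p²)_{n+1}`, with the denominators cleared: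
both sides are polynomials in `z` of degree at most `n` that agree at the `n + 1` points
`p^{-2j}`. -/
theorem prod_eq_sum_prod_erase {p : ℂ} (hp0 : p ≠ 0) (hp : ‖p‖ < 1) (n : ℕ) (z : ℂ) :
    ∏ i ∈ Finset.range n, (1 - z * p ^ (2 * i + 1)) =
      ∑ j ∈ Finset.range (n + 1), p ^ j * pochRatio p j * pochRatio p (n - j) *
        ∏ i ∈ (Finset.range (n + 1)).erase j, (1 - z * p ^ (2 * i)) := by
  let f : Polynomial ℂ := ∏ i ∈ Finset.range n, (1 - Polynomial.X * Polynomial.C (p ^ (2 * i + 1)))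
  let g : Polynomial ℂ := ∑ j ∈ Finset.range (n + 1),
    Polynomial.C (p ^ j * pochRatio p j * pochRatio p (n - j)) *
      ∏ i ∈ (Finset.range (n + 1)).erase j, (1 - Polynomial.X * Polynomial.C (p ^ (2 * i)))
  have hlin : ∀ c : ℂ, (1 - Polynomial.X * Polynomial.C c).natDegree ≤ 1 := fun c => by
    compute_degree
  have hprod : ∀ (s : Finset ℕ) (c : ℕ → ℂ),
      (∏ i ∈ s, (1 - Polynomial.X * Polynomial.C (c i))).natDegree ≤ s.card := fun s c => by
    refine (Polynomial.natDegree_prod_le _ _).trans ?_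
    simpa using Finset.sum_le_sum fun i (_ : i ∈ s) => hlin (c i)
  have hinj : Set.InjOn (fun j : ℕ => p⁻¹ ^ (2 * j)) (Finset.range (n + 1) : Set ℕ) := by
    intro i _ j _ h
    simp only [inv_pow, inv_inj] at h
    have h' := congrArg norm h
    rw [norm_pow, norm_pow] at h'
    have := (pow_right_strictAnti₀ (norm_pos_iff.mpr hp0) hp).injective h'
    omega
  have hfg : f = g := by
    refine Polynomial.eq_of_degrees_lt_of_eval_index_eq (Finset.range (n + 1)) hinj ?_ ?_ ?_
    · rw [Finset.card_range]
      refine (Polynomial.degree_le_of_natDegree_le ((hprod _ _).trans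
        (Finset.card_range n).le)).trans_lt (by exact_mod_cast n.lt_succ_self)
    · rw [Finset.card_range]
      refine (Polynomial.degree_le_of_natDegree_le (n := n) ?_).trans_lt
        (by exact_mod_cast n.lt_succ_self)
      refine Polynomial.natDegree_sum_le_of_forall_le _ _ fun j hj => ?_
      refine (Polynomial.natDegree_C_mul_le _ _).trans ((hprod _ _).trans ?_)
      rw [Finset.card_erase_of_mem hj, Finset.card_range, Nat.add_sub_cancel]
    · intro j hj
      obtain ⟨m, rfl⟩ := Nat.exists_eq_add_of_le (Nat.lt_succ_iff.mp (Finset.mem_range.mp hj))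
      simp only [f, g, Polynomial.eval_prod, Polynomial.eval_finsetSum, Polynomial.eval_sub,
        Polynomial.eval_mul, Polynomial.eval_one, Polynomial.eval_X, Polynomial.eval_C]
      rw [Finset.sum_eq_single_of_mem j hj, Nat.add_sub_cancel_left, prod_at_node hp0 hp]
      intro i _ hij
      rw [Finset.prod_eq_zero (Finset.mem_erase.mpr ⟨hij.symm, hj⟩), mul_zero]
      rw [inv_pow, inv_mul_cancel₀ (pow_ne_zero _ hp0), sub_self]
  have := congrArg (Polynomial.eval z) hfg
  simpa [f, g, Polynomial.eval_prod, Polynomial.eval_finsetSum] using this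

/-- Symmetric form of the partial fraction expansion, with poles at `y = p^{-2k}` for `|k| ≤ N`:
the previous one with `n = 2N` and `z = y p^{-2N}`. -/
theorem sum_pochRatio_div {p y : ℂ} (hp0 : p ≠ 0) (hp : ‖p‖ < 1) (hy : y ≠ 0)
    (h : ∀ k : ℤ, y * p ^ (2 * k) ≠ 1) (N : ℕ) :
    ∑ k ∈ Finset.Icc (-N : ℤ) N, p ^ k * pochRatio p (N + k).toNat * pochRatio p (N - k).toNat /
        (1 - y * p ^ (2 * k)) =
      qPoch (y * p) (p ^ 2) N * qPoch (p / y) (p ^ 2) N /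
        (qPoch y (p ^ 2) (N + 1) * qPoch (p ^ 2 / y) (p ^ 2) N) := by
  have hfac : ∀ k : ℤ, 1 - y * p ^ (2 * k) ≠ 0 := fun k => sub_ne_zero.mpr (h k).symm
  have key := prod_eq_sum_prod_erase hp0 hp (2 * N) (y * p⁻¹ ^ (2 * N))
  have hz : ∀ j : ℕ, y * p⁻¹ ^ (2 * N) * p ^ (2 * j) = y * p ^ (2 * ((j : ℤ) - N)) := fun j => by
    rw [mul_sub, zpow_sub₀ hp0, inv_pow]
    norm_cast
    field_simp
  have hsum : ∑ k ∈ Finset.Icc (-N : ℤ) N, p ^ k * pochRatio p (N + k).toNat *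
        pochRatio p (N - k).toNat / (1 - y * p ^ (2 * k)) =
      ∑ j ∈ Finset.range (2 * N + 1), p ^ ((j : ℤ) - N) * pochRatio p j *
        pochRatio p (2 * N - j) / (1 - y * p ^ (2 * ((j : ℤ) - N))) := by
    symm
    refine Finset.sum_bij (fun j _ => (j : ℤ) - N) ?_ ?_ ?_ ?_
    · intro j hj
      simp only [Finset.mem_range, Finset.mem_Icc] at *
      omega
    · intro i _ j _ hij
      omega
    · intro k hk
      simp only [Finset.mem_Icc] at hk
      exact ⟨(k + N).toNat, by simp only [Finset.mem_range]; omega, by omega⟩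
    · intro j hj
      simp only [Finset.mem_range] at hj
      rw [show ((N : ℤ) + (j - N)).toNat = j by omega,
        show ((N : ℤ) - (j - N)).toNat = 2 * N - j by omega]
  have hden : ∏ i ∈ Finset.range (2 * N + 1), (1 - y * p⁻¹ ^ (2 * N) * p ^ (2 * i)) =
      (∏ l ∈ Finset.range N, (1 - y * p⁻¹ ^ (2 * l + 2))) * qPoch y (p ^ 2) (N + 1) := by
    rw [show 2 * N + 1 = N + (N + 1) by ring, Finset.prod_range_add, ← Finset.prod_range_reflect]
    unfold qPoch
    congr 1
    · refine Finset.prod_congr rfl fun i hi => ?_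
      obtain ⟨d, rfl⟩ : ∃ d, N = i + 1 + d :=
        ⟨N - (i + 1), by have := Finset.mem_range.mp hi; omega⟩
      rw [show i + 1 + d - 1 - i = d by omega, inv_pow, inv_pow]
      field_simp
      ring
    · refine Finset.prod_congr rfl fun i hi => ?_
      rw [inv_pow]
      field_simp
      ring
  have hnum : ∏ i ∈ Finset.range (2 * N), (1 - y * p⁻¹ ^ (2 * N) * p ^ (2 * i + 1)) =
      (∏ l ∈ Finset.range N, (1 - y * p⁻¹ ^ (2 * l + 1))) * qPoch (y * p) (p ^ 2) N := by
    rw [show ∏ i ∈ Finset.range (2 * N), (1 - y * p⁻¹ ^ (2 * N) * p ^ (2 * i + 1)) =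
      ∏ i ∈ Finset.range (N + N), (1 - y * p⁻¹ ^ (2 * N) * p ^ (2 * i + 1)) by rw [two_mul],
      Finset.prod_range_add, ← Finset.prod_range_reflect]
    unfold qPoch
    congr 1
    · refine Finset.prod_congr rfl fun i hi => ?_
      obtain ⟨d, rfl⟩ : ∃ d, N = i + 1 + d :=
        ⟨N - (i + 1), by have := Finset.mem_range.mp hi; omega⟩
      rw [show i + 1 + d - 1 - i = d by omega, inv_pow, inv_pow]
      field_simp
      ring
    · refine Finset.prod_congr rfl fun i hi => ?_
      rw [inv_pow]
      field_simp
      ring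
  have hD : ∏ i ∈ Finset.range (2 * N + 1), (1 - y * p⁻¹ ^ (2 * N) * p ^ (2 * i)) ≠ 0 :=
    Finset.prod_ne_zero_iff.mpr fun i _ => by rw [hz]; exact hfac _
  have hD' := hD
  rw [hden] at hD'
  have hQ : qPoch (p ^ 2 / y) (p ^ 2) N ≠ 0 := Finset.prod_ne_zero_iff.mpr fun i _ => by
    intro h0
    have h1 := hfac (-(i + 1 : ℕ))
    rw [mul_neg, zpow_neg] at h1
    apply h1
    norm_cast
    rw [show p ^ 2 / y * (p ^ 2) ^ i = p ^ (2 * (i + 1)) / y by ring, sub_eq_zero] at h0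
    have h2 : y = p ^ (2 * (i + 1)) := by
      rw [eq_div_iff hy, one_mul] at h0
      exact h0
    rw [← h2, mul_inv_cancel₀ hy, sub_self]
  -- The factor `p ^ N` in `hrev` cancels the one coming from the shift `j = N + k` of the index.
  have hrev := prod_one_sub_inv_pow hp0 hy N
  rw [hsum]
  have hterm : ∀ j ∈ Finset.range (2 * N + 1), p ^ ((j : ℤ) - N) * pochRatio p j *
        pochRatio p (2 * N - j) / (1 - y * p ^ (2 * ((j : ℤ) - N))) =
      p⁻¹ ^ N * (p ^ j * pochRatio p j * pochRatio p (2 * N - j) *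
        ∏ i ∈ (Finset.range (2 * N + 1)).erase j, (1 - y * p⁻¹ ^ (2 * N) * p ^ (2 * i))) /
          ∏ i ∈ Finset.range (2 * N + 1), (1 - y * p⁻¹ ^ (2 * N) * p ^ (2 * i)) := by
    intro j hj
    rw [← Finset.mul_prod_erase _ _ hj] at hD ⊢
    have hE := right_ne_zero_of_mul hD
    rw [← hz, zpow_sub₀ hp0, zpow_natCast, zpow_natCast, inv_pow p N]
    have := left_ne_zero_of_mul hD
    rw [div_eq_div_iff this hD]
    ring
  rw [Finset.sum_congr rfl hterm, ← Finset.sum_div, ← Finset.mul_sum, ← key, hden, hnum,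
    div_eq_div_iff hD' (mul_ne_zero (right_ne_zero_of_mul hD') hQ)]
  have hpp : p⁻¹ ^ N * p ^ N = 1 := by rw [← mul_pow, inv_mul_cancel₀ hp0, one_pow]
  linear_combination p⁻¹ ^ N * qPoch (y * p) (p ^ 2) N * qPoch y (p ^ 2) (N + 1) * hrev +
    qPoch (y * p) (p ^ 2) N * qPoch y (p ^ 2) (N + 1) * qPoch (p / y) (p ^ 2) N *
      (∏ l ∈ Finset.range N, (1 - y * p⁻¹ ^ (2 * l + 2))) * hpp

/-! ### The bilateral series -/

theorem qPochInf_ne_zero {a q : ℂ} (hq : ‖q‖ < 1) (h : ∀ i : ℕ, a * q ^ i ≠ 1) :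
    qPochInf a q ≠ 0 := by
  unfold qPochInf
  simp only [sub_eq_add_neg]
  refine tprod_one_add_ne_zero_of_summable (fun i => ?_) ?_
  · rw [← sub_eq_add_neg]
    exact sub_ne_zero.mpr (h i).symm
  · simp only [norm_neg, norm_mul, norm_pow]
    exact (summable_geometric_of_lt_one (norm_nonneg q) hq).mul_left _

theorem tendsto_qPoch (a q : ℂ) (hq : ‖q‖ < 1) :
    Tendsto (qPoch a q) atTop (𝓝 (qPochInf a q)) := tendsto_qPochInf a q hq

theorem norm_sq_lt_one {p : ℂ} (hp : ‖p‖ < 1) : ‖p ^ 2‖ < 1 := by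
  rw [norm_pow]
  exact pow_lt_one₀ (norm_nonneg p) hp two_ne_zero

theorem qPochInf_sq_ne_zero {p : ℂ} (hp : ‖p‖ < 1) : qPochInf (p ^ 2) (p ^ 2) ≠ 0 := by
  refine qPochInf_ne_zero (norm_sq_lt_one hp) fun i h => ?_
  rw [show p ^ 2 * (p ^ 2) ^ i = p ^ (2 * i + 2) by ring] at h
  exact one_sub_pow_ne_zero hp (by omega : 2 * i + 2 ≠ 0) (by rw [h, sub_self])

theorem qPochInf_odd_ne_zero {p : ℂ} (hp : ‖p‖ < 1) : qPochInf p (p ^ 2) ≠ 0 := by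
  refine qPochInf_ne_zero (norm_sq_lt_one hp) fun i h => ?_
  rw [show p * (p ^ 2) ^ i = p ^ (2 * i + 1) by ring] at h
  exact one_sub_pow_ne_zero hp (by omega : 2 * i + 1 ≠ 0) (by rw [h, sub_self])

theorem tendsto_pochRatio {p : ℂ} (hp : ‖p‖ < 1) :
    Tendsto (pochRatio p) atTop (𝓝 (qPochInf p (p ^ 2) / qPochInf (p ^ 2) (p ^ 2))) :=
  (tendsto_qPoch _ _ (norm_sq_lt_one hp)).div (tendsto_qPoch _ _ (norm_sq_lt_one hp))
    (qPochInf_sq_ne_zero hp)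

theorem summable_pow_div {p : ℂ} (hp : ‖p‖ < 1) {w : ℕ → ℂ} (hw : Tendsto w atTop (𝓝 0))
    {u v : ℂ} (hu : u ≠ 0) : Summable fun n : ℕ => ‖p ^ n / (u - v * w n)‖ := by
  have h1 : Tendsto (fun n : ℕ => (u - v * w n)⁻¹) atTop (𝓝 (u - v * 0)⁻¹) :=
    (tendsto_const_nhds.sub (tendsto_const_nhds.mul hw)).inv₀ (by simpa using hu)
  refine summable_of_isBigO_nat (summable_geometric_of_lt_one (norm_nonneg p) hp) ?_
  simp only [div_eq_mul_inv]
  have := (Asymptotics.isBigO_refl (fun n : ℕ => p ^ n) atTop).norm_norm.mul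
    (h1.isBigO_one ℝ).norm_left
  simpa using this

theorem tendsto_pow_two_mul {p : ℂ} (hp : ‖p‖ < 1) :
    Tendsto (fun n : ℕ => p ^ (2 * n)) atTop (𝓝 0) := by
  simp only [pow_mul]
  exact tendsto_pow_atTop_nhds_zero_of_norm_lt_one (norm_sq_lt_one hp)

/-- No assumption excludes `y p^{2k} = 1`: the term in question is then `0`, as a quotient by `0`. -/
theorem summable_zpow_div {p y : ℂ} (hp0 : p ≠ 0) (hp : ‖p‖ < 1) (hy : y ≠ 0) :
    Summable fun k : ℤ => ‖p ^ k / (1 - y * p ^ (2 * k))‖ := by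
  refine Summable.of_nat_of_neg ?_ ?_
  · have := summable_pow_div hp (tendsto_pow_two_mul hp) one_ne_zero (v := y)
    exact_mod_cast this
  · refine (summable_pow_div hp (tendsto_pow_two_mul hp) hy (v := 1)).congr fun n => ?_
    rw [← norm_neg, mul_neg, zpow_neg, zpow_neg, one_mul]
    congr 1
    norm_cast
    have hpn := pow_ne_zero n hp0
    have hpn2 := pow_ne_zero (2 * n) hp0
    by_cases h : p ^ (2 * n) - y = 0
    · have h' : y = p ^ (2 * n) := (sub_eq_zero.mp h).symm
      rw [h', mul_inv_cancel₀ hpn2]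
      simp
    · have h2 : 1 - y * (p ^ (2 * n))⁻¹ = (p ^ (2 * n) - y) * (p ^ (2 * n))⁻¹ := by
        field_simp
      rw [h2, ← neg_sub (p ^ (2 * n)) y]
      field_simp
      ring

/-- The special case `x² = q` of Kronecker's bilateral expansion of a quotient of theta functions.
It is the limit of the symmetric partial fraction expansion, by dominated convergence. -/
theorem tsum_zpow_div {p y : ℂ} (hp0 : p ≠ 0) (hp : ‖p‖ < 1) (hy : y ≠ 0)
    (h : ∀ k : ℤ, y * p ^ (2 * k) ≠ 1) :
    (∑' k : ℤ, p ^ k / (1 - y * p ^ (2 * k))) *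
        (qPochInf p (p ^ 2) / qPochInf (p ^ 2) (p ^ 2)) ^ 2 =
      qPochInf (y * p) (p ^ 2) * qPochInf (p / y) (p ^ 2) /
        (qPochInf y (p ^ 2) * qPochInf (p ^ 2 / y) (p ^ 2)) := by
  set c := qPochInf p (p ^ 2) / qPochInf (p ^ 2) (p ^ 2) with hc
  have hq := norm_sq_lt_one hp
  have hy1 : qPochInf y (p ^ 2) ≠ 0 := qPochInf_ne_zero hq fun i => by
    have := h i
    rw [← pow_mul]
    exact_mod_cast this
  have hy2 : qPochInf (p ^ 2 / y) (p ^ 2) ≠ 0 := qPochInf_ne_zero hq fun i h0 => by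
    have h1 := h (-(i + 1 : ℕ))
    rw [mul_neg, zpow_neg] at h1
    apply h1
    norm_cast
    rw [show p ^ 2 / y * (p ^ 2) ^ i = p ^ (2 * (i + 1)) / y by ring, div_eq_iff hy, one_mul] at h0
    rw [h0, mul_inv_cancel₀ hy]
  obtain ⟨C, hC⟩ := (tendsto_pochRatio hp).norm.bddAbove_range
  have hC' : ∀ n, ‖pochRatio p n‖ ≤ C := fun n => hC ⟨n, rfl⟩
  have hC0 : 0 ≤ C := (norm_nonneg _).trans (hC' 0)
  let f : ℕ → ℤ → ℂ := fun N k => if k ∈ Finset.Icc (-N : ℤ) N then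
    p ^ k * pochRatio p (N + k).toNat * pochRatio p (N - k).toNat / (1 - y * p ^ (2 * k)) else 0
  have hlim : Tendsto (fun N => ∑' k, f N k) atTop
      (𝓝 (∑' k : ℤ, p ^ k / (1 - y * p ^ (2 * k)) * c ^ 2)) := by
    refine tendsto_tsum_of_dominated_convergence
      ((summable_zpow_div hp0 hp hy).mul_right (C ^ 2)) (fun k => ?_) ?_
    · have hev : ∀ᶠ N : ℕ in atTop, p ^ k / (1 - y * p ^ (2 * k)) *
          (pochRatio p (N + k).toNat * pochRatio p (N - k).toNat) = f N k := by
        filter_upwards [eventually_ge_atTop k.natAbs] with N hN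
        simp only [f]
        rw [if_pos (by rw [Finset.mem_Icc]; omega)]
        ring
      refine Tendsto.congr' hev (tendsto_const_nhds.mul ?_)
      rw [pow_two]
      refine ((tendsto_pochRatio hp).comp ?_).mul ((tendsto_pochRatio hp).comp ?_)
      · refine tendsto_atTop_mono (f := fun N : ℕ => N - k.natAbs) (fun N => by omega)
          (tendsto_sub_atTop_nat _)
      · refine tendsto_atTop_mono (f := fun N : ℕ => N - k.natAbs) (fun N => by omega)
          (tendsto_sub_atTop_nat _)
    · refine Eventually.of_forall fun N k => ?_
      simp only [f]
      split_ifs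
      · rw [show p ^ k * pochRatio p (N + k).toNat * pochRatio p (N - k).toNat /
          (1 - y * p ^ (2 * k)) = p ^ k / (1 - y * p ^ (2 * k)) *
          (pochRatio p (N + k).toNat * pochRatio p (N - k).toNat) by ring, norm_mul, norm_mul,
          pow_two]
        exact mul_le_mul_of_nonneg_left (mul_le_mul (hC' _) (hC' _) (norm_nonneg _) hC0)
          (norm_nonneg _)
      · rw [norm_zero]
        positivity
  have hfin : ∀ N, ∑' k, f N k = qPoch (y * p) (p ^ 2) N * qPoch (p / y) (p ^ 2) N /
        (qPoch y (p ^ 2) (N + 1) * qPoch (p ^ 2 / y) (p ^ 2) N) := fun N => by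
    rw [← sum_pochRatio_div hp0 hp hy h N, tsum_eq_sum (s := Finset.Icc (-N : ℤ) N)]
    · exact Finset.sum_congr rfl fun k hk => if_pos hk
    · exact fun k hk => if_neg hk
  rw [← tsum_mul_right]
  refine tendsto_nhds_unique hlim ?_
  simp only [hfin]
  exact ((tendsto_qPoch _ _ hq).mul (tendsto_qPoch _ _ hq)).div
    (((tendsto_qPoch _ _ hq).comp (tendsto_add_atTop_nat 1)).mul (tendsto_qPoch _ _ hq))
    (mul_ne_zero hy1 hy2)

/-! ### Powers of the nome and Lambert terms -/

theorem qpow_ne_zero (τ z : ℂ) : qpow τ z ≠ 0 := Complex.exp_ne_zero _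

theorem qpow_add (τ z w : ℂ) : qpow τ (z + w) = qpow τ z * qpow τ w := by
  unfold qpow
  rw [add_mul, Complex.exp_add]

theorem qpow_neg (τ z : ℂ) : qpow τ (-z) = (qpow τ z)⁻¹ := by
  unfold qpow
  rw [neg_mul, Complex.exp_neg]

theorem qpow_one (τ : ℂ) : qpow τ 1 = nome τ := by
  unfold qpow nome
  rw [one_mul]

theorem qpow_nat_mul (τ z : ℂ) (n : ℕ) : qpow τ (n * z) = qpow τ z ^ n := by
  unfold qpow
  rw [← Complex.exp_nat_mul, mul_assoc]

theorem qpow_add_nat (τ z : ℂ) (n : ℕ) : qpow τ (z + n) = qpow τ z * nome τ ^ n := by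
  rw [qpow_add, ← qpow_one, ← qpow_nat_mul, mul_one]

theorem qpow_mul_left (r τ z : ℂ) : qpow (r * τ) z = qpow τ (r * z) := by
  unfold qpow logq
  ring_nf

theorem nome_ne_zero (τ : ℂ) : nome τ ≠ 0 := Complex.exp_ne_zero _

theorem norm_qpow_ofReal (τ : ℂ) (x : ℝ) : ‖qpow τ x‖ = Real.exp (-(Real.pi * τ.im * x)) := by
  unfold qpow logq
  rw [Complex.norm_exp]
  congr 1
  simp
  ring

theorem norm_qpow_lt_one {τ : ℂ} (hτ : 0 < τ.im) {x : ℝ} (hx : 0 < x) : ‖qpow τ x‖ < 1 := by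
  rw [norm_qpow_ofReal, Real.exp_lt_one_iff, neg_lt_zero]
  have := Real.pi_pos
  positivity

theorem norm_nome_lt_one {τ : ℂ} (hτ : 0 < τ.im) : ‖nome τ‖ < 1 := by
  rw [← qpow_one]
  exact_mod_cast norm_qpow_lt_one hτ one_pos

theorem qpow_ofReal_ne_one {τ : ℂ} (hτ : 0 < τ.im) {x : ℝ} (hx : x ≠ 0) : qpow τ x ≠ 1 := by
  intro h
  have h1 := norm_qpow_ofReal τ x
  rw [h, norm_one, eq_comm, Real.exp_eq_one_iff, neg_eq_zero] at h1
  have := mul_pos Real.pi_pos hτ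
  exact hx ((mul_eq_zero.mp h1).resolve_left this.ne')

/-- The Lambert term `q^x / (1 - q^x)`. -/
noncomputable def lambertTerm (τ x : ℂ) : ℂ := qpow τ x / (1 - qpow τ x)

theorem summable_lambertTerm {τ : ℂ} (hτ : 0 < τ.im) (z : ℂ) :
    Summable fun i : ℕ => lambertTerm τ (z + i) := by
  have hq := norm_nome_lt_one hτ
  refine ((summable_pow_div hq (tendsto_pow_atTop_nhds_zero_of_norm_lt_one hq) one_ne_zero
    (v := qpow τ z)).of_norm.mul_left (qpow τ z)).congr fun i => ?_
  unfold lambertTerm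
  rw [qpow_add_nat, mul_div_assoc]

theorem hasDerivAt_qpow (τ z : ℂ) : HasDerivAt (qpow τ) (logq τ * qpow τ z) z := by
  have h := ((hasDerivAt_id' z).mul_const (logq τ)).cexp
  exact h.congr_deriv (by rw [one_mul, mul_comm]; rfl)

theorem one_sub_nome_ne_zero {τ : ℂ} (hτ : 0 < τ.im) : 1 - nome τ ≠ 0 := by
  simpa using one_sub_pow_ne_zero (norm_nome_lt_one hτ) one_ne_zero

/-! ### The Lambert series of the `q`-digamma function -/

/-- The factors `1 - q^{w+i}` are uniformly close to `1` on a unit ball, as `|q^w|` is bounded there.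
The ball only serves as a neighbourhood of its centre. -/
theorem multipliableLocallyUniformlyOn_one_sub_qpow {τ : ℂ} (hτ : 0 < τ.im) (z : ℂ) :
    MultipliableLocallyUniformlyOn (fun (i : ℕ) w => 1 + -(qpow τ w * nome τ ^ i))
      (Metric.ball z 1) := by
  have hq := norm_nome_lt_one hτ
  refine Summable.multipliableLocallyUniformlyOn_nat_one_add Metric.isOpen_ball
    (u := fun i => Real.exp ((‖z‖ + 1) * ‖logq τ‖) * ‖nome τ‖ ^ i)
    ((summable_geometric_of_lt_one (norm_nonneg _) hq).mul_left _)
    (Eventually.of_forall fun i w hw => ?_) fun i => ?_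
  · rw [norm_neg, norm_mul, norm_pow]
    refine mul_le_mul_of_nonneg_right ?_ (by positivity)
    unfold qpow
    refine (Complex.norm_exp_le_exp_norm _).trans (Real.exp_le_exp.mpr ?_)
    rw [norm_mul]
    refine mul_le_mul_of_nonneg_right ?_ (norm_nonneg _)
    have h1 : ‖w - z‖ < 1 := by simpa [dist_eq_norm] using hw
    have h2 := norm_add_le (w - z) z
    rw [sub_add_cancel] at h2
    linarith
  · refine Continuous.continuousOn ?_
    have : Continuous (qpow τ) := continuous_iff_continuousAt.mpr fun w =>
      (hasDerivAt_qpow τ w).continuousAt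
    fun_prop

theorem differentiable_qpow (τ : ℂ) : Differentiable ℂ (qpow τ) :=
  fun w => (hasDerivAt_qpow τ w).differentiableAt

theorem qPochInf_qpow_ne_zero {τ : ℂ} (hτ : 0 < τ.im) {z : ℂ}
    (hz : ∀ i : ℕ, qpow τ (z + i) ≠ 1) : qPochInf (qpow τ z) (nome τ) ≠ 0 :=
  qPochInf_ne_zero (norm_nome_lt_one hτ) fun i => by rw [← qpow_add_nat]; exact hz i

theorem differentiableAt_qPochInf_qpow {τ : ℂ} (hτ : 0 < τ.im) (z : ℂ) :
    DifferentiableAt ℂ (fun w => qPochInf (qpow τ w) (nome τ)) z := by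
  have hd := differentiable_qpow τ
  have h := (multipliableLocallyUniformlyOn_one_sub_qpow hτ z).hasProdLocallyUniformlyOn
  have h' := TendstoLocallyUniformlyOn.differentiableOn h
    (Eventually.of_forall fun s => by fun_prop) Metric.isOpen_ball
  have hmem := Metric.isOpen_ball.mem_nhds (Metric.mem_ball_self (x := z) one_pos)
  refine (h'.differentiableAt hmem).congr_of_eventuallyEq ?_
  refine Eventually.of_forall fun w => ?_
  simp only [qPochInf, sub_eq_add_neg]

theorem logDeriv_qPochInf_qpow {τ : ℂ} (hτ : 0 < τ.im) {z : ℂ}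
    (hz : ∀ i : ℕ, qpow τ (z + i) ≠ 1) :
    logDeriv (fun w => qPochInf (qpow τ w) (nome τ)) z =
      -(logq τ * ∑' i : ℕ, lambertTerm τ (z + i)) := by
  have hd := differentiable_qpow τ
  have hterm : ∀ i : ℕ, logDeriv (fun w => 1 + -(qpow τ w * nome τ ^ i)) z =
      -logq τ * lambertTerm τ (z + i) := fun i => by
    have h1 : HasDerivAt (fun w => 1 + -(qpow τ w * nome τ ^ i))
        (-(logq τ * qpow τ z * nome τ ^ i)) z :=
      ((hasDerivAt_qpow τ z).mul_const (nome τ ^ i)).neg.const_add 1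
    rw [logDeriv_apply, h1.deriv, lambertTerm, qpow_add_nat]
    ring
  have hne := qPochInf_qpow_ne_zero hτ hz
  unfold qPochInf at hne ⊢
  simp only [sub_eq_add_neg] at hne ⊢
  rw [logDeriv_tprod_eq_tsum Metric.isOpen_ball (Metric.mem_ball_self one_pos) (fun i => ?nonzero)
    (fun i => by fun_prop) ?summable (multipliableLocallyUniformlyOn_one_sub_qpow hτ z) hne]
  · simp only [hterm]
    rw [tsum_mul_left, neg_mul]
  case nonzero =>
    rw [← sub_eq_add_neg, ← qpow_add_nat]
    exact sub_ne_zero.mpr (hz i).symm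
  case summable =>
    simp only [hterm]
    exact (summable_lambertTerm hτ z).mul_left _

theorem hasDerivAt_cpow_one_sub {c : ℂ} (hc : c ≠ 0) (z : ℂ) :
    HasDerivAt (fun w : ℂ => c ^ (1 - w)) (-(Complex.log c) * c ^ (1 - z)) z := by
  have h := ((hasDerivAt_id' z).const_sub 1).const_cpow (c := c) (Or.inl hc)
  exact h.congr_deriv (by ring)

theorem qGamma_ne_zero {τ : ℂ} (hτ : 0 < τ.im) {z : ℂ}
    (hz : ∀ i : ℕ, qpow τ (z + i) ≠ 1) : qGamma τ z ≠ 0 := by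
  refine mul_ne_zero (div_ne_zero ?_ (qPochInf_qpow_ne_zero hτ hz)) ?_
  · have h1 := qPochInf_qpow_ne_zero hτ (z := 1) fun i => ?_
    · rwa [qpow_one] at h1
    exact_mod_cast qpow_ofReal_ne_one hτ (x := 1 + i) (by positivity)
  · rw [Complex.cpow_def_of_ne_zero (one_sub_nome_ne_zero hτ)]
    exact Complex.exp_ne_zero _

theorem differentiableAt_qGamma {τ : ℂ} (hτ : 0 < τ.im) {z : ℂ}
    (hz : ∀ i : ℕ, qpow τ (z + i) ≠ 1) : DifferentiableAt ℂ (qGamma τ) z :=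
  ((differentiableAt_const _).div (differentiableAt_qPochInf_qpow hτ z)
    (qPochInf_qpow_ne_zero hτ hz)).mul
    (hasDerivAt_cpow_one_sub (one_sub_nome_ne_zero hτ) z).differentiableAt

/-- The Lambert series of the `q`-digamma function. -/
theorem qDigamma_eq {τ : ℂ} (hτ : 0 < τ.im) {z : ℂ} (hz : ∀ i : ℕ, qpow τ (z + i) ≠ 1) :
    qDigamma τ z =
      -Complex.log (1 - nome τ) + logq τ * ∑' i : ℕ, lambertTerm τ (z + i) := by
  have hΓ := qGamma_ne_zero hτ hz
  have h1 := left_ne_zero_of_mul hΓ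
  have h2 := right_ne_zero_of_mul hΓ
  have hP := qPochInf_qpow_ne_zero hτ hz
  have hD := differentiableAt_qPochInf_qpow hτ z
  have hc := hasDerivAt_cpow_one_sub (one_sub_nome_ne_zero hτ) z
  have h3 : qPochInf (nome τ) (nome τ) ≠ 0 := by
    intro h
    rw [h, zero_div] at h1
    exact h1 rfl
  have : qDigamma τ z = logDeriv (fun w => qPochInf (nome τ) (nome τ) /
      qPochInf (qpow τ w) (nome τ) * (1 - nome τ) ^ (1 - w)) z := rfl
  rw [this, logDeriv_mul (f := fun w => qPochInf (nome τ) (nome τ) /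
      qPochInf (qpow τ w) (nome τ)) z h1 h2 ((differentiableAt_const _).div hD hP)
      hc.differentiableAt,
    logDeriv_div (f := fun _ => qPochInf (nome τ) (nome τ)) z h3 hP (differentiableAt_const _) hD,
    logDeriv_qPochInf_qpow hτ hz, logDeriv_const, logDeriv_apply (fun w => (1 - nome τ) ^ (1 - w)),
    hc.deriv, mul_div_cancel_right₀ _ h2]
  simp
  ring

/-! ### Reflection, periodicity, and the `q`-cotangent -/

/-- The antisymmetrised Lambert series `∑_{i ≥ 0} (L(z + i) - L(1 - z + i))`, where
`L(x) = q^x / (1 - q^x)`, corrected by `1/2 - z`.  It is the `q`-analogue of the cotangent, normalised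
so as to have period one. -/
noncomputable def lambertCot (τ z : ℂ) : ℂ :=
  ∑' i : ℕ, lambertTerm τ (z + i) - ∑' i : ℕ, lambertTerm τ (1 - z + i) - z + 1 / 2

theorem lambertCot_one_sub (τ z : ℂ) : lambertCot τ (1 - z) = -lambertCot τ z := by
  unfold lambertCot
  rw [sub_sub_cancel]
  ring

theorem lambertTerm_add_neg {τ z : ℂ} (hz : qpow τ z ≠ 1) :
    lambertTerm τ z + lambertTerm τ (-z) = -1 := by
  unfold lambertTerm
  rw [qpow_neg]
  have h0 := qpow_ne_zero τ z
  have h1 : 1 - qpow τ z ≠ 0 := sub_ne_zero.mpr hz.symm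
  have h2 : 1 - (qpow τ z)⁻¹ = -(1 - qpow τ z) / qpow τ z := by
    field_simp
    ring
  rw [h2]
  field_simp
  ring

theorem lambertCot_add_one {τ : ℂ} (hτ : 0 < τ.im) {z : ℂ} (hz : qpow τ z ≠ 1) :
    lambertCot τ (z + 1) = lambertCot τ z := by
  unfold lambertCot
  have h1 := (summable_lambertTerm hτ z).tsum_eq_zero_add
  have h2 := (summable_lambertTerm hτ (1 - (z + 1))).tsum_eq_zero_add
  simp only [Nat.cast_zero, add_zero, Nat.cast_add, Nat.cast_one] at h1 h2
  have e1 : ∀ i : ℕ, z + 1 + (i : ℂ) = z + (i + 1) := fun i => by ring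
  have e2 : ∀ i : ℕ, 1 - (z + 1) + ((i : ℂ) + 1) = 1 - z + i := fun i => by ring
  simp only [e2] at h2
  rw [h1, h2]
  simp only [e1]
  rw [show 1 - (z + 1) = -z by ring]
  linear_combination -lambertTerm_add_neg hz

theorem lambertCot_add_int {τ : ℂ} (hτ : 0 < τ.im) {z : ℂ} (hz : ∀ n : ℤ, qpow τ (z + n) ≠ 1)
    (n : ℤ) : lambertCot τ (z + n) = lambertCot τ z := by
  induction n using Int.induction_on with
  | zero => simp
  | succ n ih =>
    rw [← ih, ← lambertCot_add_one hτ (hz n)]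
    push_cast
    ring_nf
  | pred n ih =>
    rw [← ih, ← lambertCot_add_one hτ (hz _)]
    push_cast
    ring_nf

theorem qDigamma_sub {τ : ℂ} (hτ : 0 < τ.im) {z : ℂ} (hz : ∀ n : ℤ, qpow τ (z + n) ≠ 1) :
    qDigamma τ z - qDigamma τ (1 - z) = logq τ * (lambertCot τ z + z - 1 / 2) := by
  rw [qDigamma_eq hτ fun i => by exact_mod_cast hz i, qDigamma_eq hτ fun i => ?_]
  · unfold lambertCot
    ring
  · intro h
    have := hz (-(1 + i))
    apply this
    rw [← inv_inj, ← qpow_neg, inv_one, ← h]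
    push_cast
    ring_nf

/-- Gosper's `q`-cotangent as a Lambert series.  The base of the series is `q²`, because the gamma
functions in the `q`-sine have that base. -/
theorem qCot_eq {τ : ℂ} (hτ : 0 < τ.im) {z : ℂ} (hz : ∀ n : ℤ, qpow (2 * τ) (z + n) ≠ 1) :
    Real.pi * qCot τ (z * Real.pi) = -(2 * logq τ * lambertCot (2 * τ) z) := by
  have hτ2 : 0 < (2 * τ).im := by simpa using hτ
  have hπ : (Real.pi : ℂ) ≠ 0 := by exact_mod_cast Real.pi_ne_zero
  have hz1 : ∀ i : ℕ, qpow (2 * τ) (z + i) ≠ 1 := fun i => by exact_mod_cast hz i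
  have hz2 : ∀ i : ℕ, qpow (2 * τ) (1 - z + i) ≠ 1 := fun i h => by
    apply hz (-(1 + i))
    rw [← inv_inj, ← qpow_neg, inv_one, ← h]
    push_cast
    ring_nf
  set K := qpow τ (1 / 4) * qGamma (2 * τ) (1 / 2) ^ 2 with hKdef
  have hK : K ≠ 0 := by
    refine mul_ne_zero (qpow_ne_zero _ _) (pow_ne_zero _ (qGamma_ne_zero hτ2 fun i => ?_))
    have := qpow_ofReal_ne_one hτ2 (x := 1 / 2 + i) (by positivity)
    push_cast at this
    exact this
  let S : ℂ → ℂ := fun z => K * qpow τ (z * (z - 1)) / (qGamma (2 * τ) z * qGamma (2 * τ) (1 - z))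
  have hS : qSin τ = S ∘ fun w => w / (Real.pi : ℂ) := rfl
  have hΓ1 := qGamma_ne_zero hτ2 hz1
  have hΓ2 := qGamma_ne_zero hτ2 hz2
  have hd1 := differentiableAt_qGamma hτ2 hz1
  have hd2 := differentiableAt_qGamma hτ2 hz2
  have hsub : HasDerivAt (fun w : ℂ => 1 - w) (-1) z := by
    simpa using (hasDerivAt_id z).const_sub 1
  have hd2' : DifferentiableAt ℂ (fun w => qGamma (2 * τ) (1 - w)) z :=
    DifferentiableAt.comp z (f := fun w : ℂ => 1 - w) hd2 hsub.differentiableAt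
  have hpoly : HasDerivAt (fun w : ℂ => w * (w - 1)) (2 * z - 1) z := by
    have := (hasDerivAt_id' z).mul ((hasDerivAt_id' z).sub_const 1)
    exact this.congr_deriv (by ring)
  have hqp : HasDerivAt (fun w => K * qpow τ (w * (w - 1)))
      (K * (logq τ * qpow τ (z * (z - 1)) * (2 * z - 1))) z :=
    (HasDerivAt.comp z (h₂ := qpow τ) (hasDerivAt_qpow τ (z * (z - 1))) hpoly).const_mul K
  have hlogS : logDeriv S z = logq τ * (2 * z - 1) -
      (qDigamma (2 * τ) z - qDigamma (2 * τ) (1 - z)) := by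
    have hq0 := qpow_ne_zero τ (z * (z - 1))
    have hrefl : logDeriv (fun w => qGamma (2 * τ) (1 - w)) z = -qDigamma (2 * τ) (1 - z) := by
      have := logDeriv_comp (f := qGamma (2 * τ)) (g := fun w : ℂ => 1 - w) hd2
        hsub.differentiableAt
      rw [hsub.deriv] at this
      refine this.trans ?_
      rw [mul_neg_one]
      rfl
    change logDeriv (fun w => K * qpow τ (w * (w - 1)) /
      (qGamma (2 * τ) w * qGamma (2 * τ) (1 - w))) z = _
    rw [logDeriv_div (f := fun w => K * qpow τ (w * (w - 1)))
      (g := fun w => qGamma (2 * τ) w * qGamma (2 * τ) (1 - w)) z (mul_ne_zero hK hq0)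
      (mul_ne_zero hΓ1 hΓ2) hqp.differentiableAt (hd1.mul hd2'),
      logDeriv_mul (g := fun w => qGamma (2 * τ) (1 - w)) z hΓ1 hΓ2 hd1 hd2', hrefl,
      logDeriv_apply (fun w => K * qpow τ (w * (w - 1))), hqp.deriv, logDeriv_apply]
    unfold qDigamma
    field_simp
    ring
  have hzz : z * (Real.pi : ℂ) / Real.pi = z := mul_div_cancel_right₀ z hπ
  have hSd : DifferentiableAt ℂ S z :=
    hqp.differentiableAt.div (hd1.mul hd2') (mul_ne_zero hΓ1 hΓ2)
  have hdiv : HasDerivAt (fun w : ℂ => w / (Real.pi : ℂ)) (1 / (Real.pi : ℂ)) (z * Real.pi) :=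
    (hasDerivAt_id _).div_const _
  have hcot : qCot τ (z * Real.pi) = logDeriv S z * (1 / (Real.pi : ℂ)) := by
    change logDeriv (qSin τ) (z * Real.pi) = _
    rw [hS, logDeriv_comp (by rwa [hzz]) hdiv.differentiableAt, hdiv.deriv, hzz]
  have hlog2 : logq (2 * τ) = 2 * logq τ := by
    unfold logq
    ring
  rw [hcot, hlogS, qDigamma_sub hτ2 hz, hlog2]
  field_simp
  ring

/-! ### Sums over equally spaced points -/

theorem lambertTerm_div (τ x M : ℂ) : lambertTerm τ (x / M) = lambertTerm (τ / M) x := by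
  unfold lambertTerm qpow logq
  ring_nf

/-- A series summed by residue classes, with the classes indexed by `Finset.range M`. -/
theorem sum_tsum_residue {f : ℕ → ℂ} (hf : Summable f) {M : ℕ} (hM : 0 < M) :
    ∑ k ∈ Finset.range M, ∑' i : ℕ, f (k + M * i) = ∑' n, f n := by
  obtain ⟨m, rfl⟩ := Nat.exists_eq_succ_of_ne_zero hM.ne'
  rw [Nat.sumByResidueClasses hf (m + 1)]
  exact (Fin.sum_univ_eq_sum_range (fun k => ∑' i : ℕ, f (k + (m + 1) * i)) (m + 1)).symm

theorem div_natCast_im_pos {τ : ℂ} (hτ : 0 < τ.im) {M : ℕ} (hM : 0 < M) : 0 < (τ / M).im := by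
  rw [Complex.div_natCast_im]
  positivity

theorem sum_tsum_lambertTerm {τ : ℂ} (hτ : 0 < τ.im) {M : ℕ} (hM : 0 < M) (c : ℂ) :
    ∑ k ∈ Finset.range M, ∑' i : ℕ, lambertTerm τ ((k + c) / M + i) =
      ∑' n : ℕ, lambertTerm (τ / M) (c + n) := by
  have hM' : (M : ℂ) ≠ 0 := by exact_mod_cast hM.ne'
  rw [← sum_tsum_residue (summable_lambertTerm (div_natCast_im_pos hτ hM) c) hM]
  refine Finset.sum_congr rfl fun k _ => tsum_congr fun i => ?_
  rw [← lambertTerm_div]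
  congr 1
  push_cast
  field_simp
  ring

/-- Summing over the points `(k + b) / M` for `k = 1, …, M` merges the Lambert series in base `q`
into a single one in base `q^{1/M}`. -/
theorem sum_qDigamma_sub {τ : ℂ} (hτ : 0 < τ.im) {M : ℕ} (hM : 0 < M) {b : ℂ}
    (hb : ∀ n : ℤ, qpow (τ / M) (b + n) ≠ 1) :
    ∑ k ∈ Finset.Icc 1 M, (qDigamma τ ((k + b) / M) - qDigamma τ (1 - (k + b) / M)) =
      logq τ * (lambertCot (τ / M) b + b + 1 / 2) := by
  have hM' : (M : ℂ) ≠ 0 := by exact_mod_cast hM.ne'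
  have hz : ∀ (k : ℕ) (n : ℤ), qpow τ ((k + b) / M + n) ≠ 1 := fun k n => by
    have h := hb (k + M * n)
    have h1 : qpow τ ((k + b) / M + n) = qpow (τ / M) (b + ((k + M * n : ℤ) : ℂ)) := by
      unfold qpow logq
      congr 1
      push_cast
      field_simp
      ring
    rwa [h1]
  have h1 : ∀ k : ℕ, qDigamma τ ((k + b) / M) - qDigamma τ (1 - (k + b) / M) =
      logq τ * (∑' i : ℕ, lambertTerm τ ((k + b) / M + i) -
        ∑' i : ℕ, lambertTerm τ (1 - (k + b) / M + i)) := fun k => by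
    rw [qDigamma_sub hτ (hz k), lambertCot]
    ring
  simp only [h1]
  rw [← Finset.mul_sum, Finset.sum_sub_distrib, ← Finset.Ico_add_one_right_eq_Icc,
    Finset.sum_Ico_eq_sum_range, Finset.sum_Ico_eq_sum_range, Nat.add_sub_cancel]
  have hA : ∑ k ∈ Finset.range M, ∑' i : ℕ, lambertTerm τ ((((1 + k : ℕ) : ℂ) + b) / M + i) =
      ∑' n : ℕ, lambertTerm (τ / M) (b + 1 + n) := by
    rw [← sum_tsum_lambertTerm hτ hM]
    refine Finset.sum_congr rfl fun k _ => ?_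
    push_cast
    simp only [show (1 + (k : ℂ) + b) = k + (b + 1) by ring]
  have hB : ∑ k ∈ Finset.range M, ∑' i : ℕ,
        lambertTerm τ (1 - (((1 + k : ℕ) : ℂ) + b) / M + i) =
      ∑' n : ℕ, lambertTerm (τ / M) (1 - (b + 1) + n) := by
    rw [← sum_tsum_lambertTerm hτ hM, ← Finset.sum_range_reflect]
    refine Finset.sum_congr rfl fun k hk => ?_
    have hk' : 1 + (M - 1 - k) + k = M := by
      have := Finset.mem_range.mp hk
      omega
    have : (1 - (((1 + (M - 1 - k) : ℕ) : ℂ) + b) / M) = ((k : ℂ) + (1 - (b + 1))) / M := by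
      have hc := congrArg (Nat.cast (R := ℂ)) hk'
      rw [Nat.cast_add (1 + (M - 1 - k)) k] at hc
      field_simp
      linear_combination -hc
    rw [this]
  rw [hA, hB]
  have h0 := hb 0
  rw [Int.cast_zero, add_zero] at h0
  have := lambertCot_add_one (div_natCast_im_pos hτ hM) h0
  rw [← this, lambertCot]
  ring

/-! ### Lambert series as infinite products -/

/-- Expanding each term in a geometric series and exchanging the two summations. -/
theorem tsum_geometric_swap {x q : ℂ} (hx : ‖x‖ < 1) (hq : ‖q‖ < 1) :
    ∑' n : ℕ, x * q ^ n / (1 - x * q ^ n) = ∑' k : ℕ, x ^ (k + 1) / (1 - q ^ (k + 1)) := by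
  have hs : Summable fun a : ℕ × ℕ => x ^ (a.2 + 1) * q ^ (a.1 * (a.2 + 1)) := by
    refine Summable.of_norm_bounded (g := fun a : ℕ × ℕ => ‖q‖ ^ a.1 * ‖x‖ ^ a.2) ?_ fun a => ?_
    · exact (summable_geometric_of_lt_one (norm_nonneg _) hq).mul_of_nonneg
        (summable_geometric_of_lt_one (norm_nonneg _) hx) (fun _ => by positivity)
        (fun _ => by positivity)
    · rw [norm_mul, norm_pow, norm_pow, mul_comm]
      refine mul_le_mul ?_ ?_ (by positivity) (by positivity)
      · exact pow_le_pow_of_le_one (norm_nonneg _) hq.le (Nat.le_mul_of_pos_right _ (by omega))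
      · exact pow_le_pow_of_le_one (norm_nonneg _) hx.le (by omega)
  have h1 : ∀ n : ℕ, x * q ^ n / (1 - x * q ^ n) =
      ∑' k : ℕ, x ^ (k + 1) * q ^ (n * (k + 1)) := fun n => by
    have hn : ‖x * q ^ n‖ < 1 := by
      rw [norm_mul, norm_pow]
      exact (mul_le_of_le_one_right (norm_nonneg _)
        (pow_le_one₀ (norm_nonneg _) hq.le)).trans_lt hx
    rw [div_eq_mul_inv, ← tsum_geometric_of_norm_lt_one hn, ← tsum_mul_left]
    refine tsum_congr fun k => ?_
    ring
  have h2 : ∀ k : ℕ, x ^ (k + 1) / (1 - q ^ (k + 1)) =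
      ∑' n : ℕ, x ^ (k + 1) * q ^ (n * (k + 1)) := fun k => by
    have hk : ‖q ^ (k + 1)‖ < 1 := by
      rw [norm_pow]
      exact pow_lt_one₀ (norm_nonneg _) hq (by omega)
    rw [div_eq_mul_inv, ← tsum_geometric_of_norm_lt_one hk, ← tsum_mul_left]
    refine tsum_congr fun n => ?_
    ring
  simp only [h1, h2]
  exact (Summable.tsum_comm (f := fun n k : ℕ => x ^ (k + 1) * q ^ (n * (k + 1))) hs).symm

theorem summable_pow_div_one_sub {x q : ℂ} (hx : ‖x‖ < 1) (hq : ‖q‖ < 1) :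
    Summable fun k : ℕ => x ^ (k + 1) / (1 - q ^ (k + 1)) := by
  have := (summable_pow_div hx (tendsto_pow_atTop_nhds_zero_of_norm_lt_one hq) one_ne_zero
    (v := 1)).of_norm
  simp only [one_mul] at this
  exact (summable_nat_add_iff 1).mpr this

theorem qPochInf_eq_one_sub_mul {q : ℂ} (hq : ‖q‖ < 1) (a : ℂ) :
    qPochInf a q = (1 - a) * qPochInf (a * q) q := by
  refine tendsto_nhds_unique ((tendsto_qPoch a q hq).comp (tendsto_add_atTop_nat 1)) ?_
  refine ((tendsto_qPoch (a * q) q hq).const_mul (1 - a)).congr fun n => ?_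
  simp only [Function.comp_apply, qPoch]
  rw [Finset.prod_range_succ', mul_comm, pow_zero, mul_one]
  congr 1
  exact Finset.prod_congr rfl fun i _ => by ring

theorem qPochInf_mul_neg {q : ℂ} (hq : ‖q‖ < 1) (a : ℂ) :
    qPochInf a q * qPochInf (-a) q = qPochInf (a ^ 2) (q ^ 2) := by
  refine tendsto_nhds_unique ((tendsto_qPoch a q hq).mul (tendsto_qPoch (-a) q hq)) ?_
  refine (tendsto_qPoch (a ^ 2) (q ^ 2) (norm_sq_lt_one hq)).congr fun n => ?_
  unfold qPoch
  rw [← Finset.prod_mul_distrib]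
  exact Finset.prod_congr rfl fun i _ => by ring

theorem qPochInf_mul_cube_roots {q ω : ℂ} (hq : ‖q‖ < 1) (hω : 1 + ω + ω ^ 2 = 0) (a : ℂ) :
    qPochInf a q * (qPochInf (ω * a) q * qPochInf (ω ^ 2 * a) q) = qPochInf (a ^ 3) (q ^ 3) := by
  refine tendsto_nhds_unique ((tendsto_qPoch a q hq).mul
    ((tendsto_qPoch (ω * a) q hq).mul (tendsto_qPoch (ω ^ 2 * a) q hq))) ?_
  have hq3 : ‖q ^ 3‖ < 1 := by
    rw [norm_pow]
    exact pow_lt_one₀ (norm_nonneg _) hq (by norm_num)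
  refine (tendsto_qPoch (a ^ 3) (q ^ 3) hq3).congr fun n => ?_
  unfold qPoch
  rw [← Finset.prod_mul_distrib, ← Finset.prod_mul_distrib]
  refine Finset.prod_congr rfl fun i _ => ?_
  linear_combination (a * q ^ i - a ^ 2 * q ^ (2 * i) * ω + a ^ 3 * q ^ (3 * i) * (ω - 1)) * hω

/-- Pairing the terms `k` and `-k` of the bilateral series.  A term with `y p^{2k} = 1` is `0` on
both sides, as a quotient by `0`. -/
theorem tsum_zpow_div_eq {p y : ℂ} (hp0 : p ≠ 0) (hp : ‖p‖ < 1) (hy : y ≠ 0) :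
    ∑' k : ℤ, p ^ k / (1 - y * p ^ (2 * k)) = 1 / (1 - y) +
      ∑' k : ℕ, (p ^ (k + 1) / (1 - y * (p ^ (k + 1)) ^ 2) +
        p ^ (k + 1) / ((p ^ (k + 1)) ^ 2 - y)) := by
  let f : ℤ → ℂ := fun k => p ^ k / (1 - y * p ^ (2 * k))
  have hs : Summable f := (summable_zpow_div hp0 hp hy).of_norm
  have hs1 : Summable fun n : ℕ => f (n + 1) :=
    hs.comp_injective (i := fun n : ℕ => (n : ℤ) + 1) fun a b hab => by
      have : (a : ℤ) + 1 = b + 1 := hab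
      omega
  have hs2 : Summable fun n : ℕ => f (-(n + 1)) :=
    hs.comp_injective (i := fun n : ℕ => -((n : ℤ) + 1)) fun a b hab => by
      have : -((a : ℤ) + 1) = -(b + 1) := hab
      omega
  have h0 : f 0 = 1 / (1 - y) := by simp [f]
  have h1 : ∀ k : ℕ, f (k + 1) = p ^ (k + 1) / (1 - y * (p ^ (k + 1)) ^ 2) := fun k => by
    simp only [f]
    rw [← pow_mul, mul_comm (k + 1)]
    norm_cast
  have h2 : ∀ k : ℕ, f (-(k + 1)) = p ^ (k + 1) / ((p ^ (k + 1)) ^ 2 - y) := fun k => by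
    simp only [f]
    have e1 : p ^ (-((k : ℤ) + 1)) = (p ^ (k + 1))⁻¹ := by
      rw [zpow_neg]
      norm_cast
    have e2 : p ^ (2 * -((k : ℤ) + 1)) = ((p ^ (k + 1)) ^ 2)⁻¹ := by
      rw [mul_neg, zpow_neg, ← pow_mul, mul_comm (k + 1)]
      norm_cast
    have hx := pow_ne_zero (k + 1) hp0
    rw [e1, e2]
    generalize p ^ (k + 1) = x at hx
    rw [show 1 - y * (x ^ 2)⁻¹ = (x ^ 2 - y) * (x ^ 2)⁻¹ by field_simp]
    field_simp
  change ∑' k, f k = _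
  rw [tsum_of_add_one_of_neg_add_one hs1 hs2, add_right_comm, ← hs1.tsum_add hs2, add_comm, h0]
  simp only [h1, h2]

theorem root_of_unity_mul_zpow_ne_one {p y : ℂ} (hp0 : p ≠ 0) (hp : ‖p‖ < 1) {m : ℕ} (hm : m ≠ 0)
    (hy : y ^ m = 1) (hy1 : y ≠ 1) (k : ℤ) : y * p ^ (2 * k) ≠ 1 := by
  intro h
  have h1 := congrArg norm h
  rw [norm_mul, norm_zpow, Complex.norm_eq_one_of_pow_eq_one hy hm, one_mul, norm_one] at h1
  have h2 := (zpow_right_strictAnti₀ (norm_pos_iff.mpr hp0) hp).injective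
    (h1.trans (zpow_zero ‖p‖).symm)
  rw [h2, zpow_zero, mul_one] at h
  exact hy1 h

/-- The Lambert series counting representations by a sum of two squares, as an infinite product:
the bilateral series at `y = -1`. -/
theorem lambert_four {p : ℂ} (hp0 : p ≠ 0) (hp : ‖p‖ < 1) :
    1 + 4 * ∑' k : ℕ, (p ^ (k + 1) / (1 - (p ^ 4) ^ (k + 1)) -
        (p ^ 3) ^ (k + 1) / (1 - (p ^ 4) ^ (k + 1))) =
      (qPochInf (p ^ 2) (p ^ 2) / qPochInf p (p ^ 2)) ^ 4 /
        (qPochInf (p ^ 4) (p ^ 4) / qPochInf (p ^ 2) (p ^ 4)) ^ 2 := by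
  have hq := norm_sq_lt_one hp
  have hk := root_of_unity_mul_zpow_ne_one hp0 hp (m := 2) (y := -1) two_ne_zero (by norm_num)
    (by norm_num)
  have key := tsum_zpow_div hp0 hp (neg_ne_zero.mpr one_ne_zero) hk
  rw [tsum_zpow_div_eq hp0 hp (neg_ne_zero.mpr one_ne_zero)] at key
  have hterm : ∀ k : ℕ, p ^ (k + 1) / (1 - -1 * (p ^ (k + 1)) ^ 2) +
        p ^ (k + 1) / ((p ^ (k + 1)) ^ 2 - -1) = 2 * (p ^ (k + 1) / (1 - (p ^ 4) ^ (k + 1)) -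
        (p ^ 3) ^ (k + 1) / (1 - (p ^ 4) ^ (k + 1))) := fun k => by
    have h4 := one_sub_pow_ne_zero hp (by omega : 4 * (k + 1) ≠ 0)
    rw [pow_right_comm p 3, pow_right_comm p 4]
    rw [mul_comm 4, pow_mul] at h4
    set x := p ^ (k + 1)
    have h5 : 1 - x ^ 4 = (1 - x ^ 2) * (1 + x ^ 2) := by ring
    rw [h5] at h4 ⊢
    have := left_ne_zero_of_mul h4
    have := right_ne_zero_of_mul h4
    rw [show 1 - -1 * x ^ 2 = 1 + x ^ 2 by ring, show x ^ 2 - -1 = 1 + x ^ 2 by ring]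
    field_simp
    ring
  simp only [hterm] at key
  rw [tsum_mul_left] at key
  have e1 := qPochInf_mul_neg hq p
  have e2 := qPochInf_mul_neg hq (p ^ 2)
  have e3 := qPochInf_eq_one_sub_mul hq (-1)
  have n1 := qPochInf_odd_ne_zero hp
  have n2 := qPochInf_sq_ne_zero hp
  have n3 := qPochInf_sq_ne_zero hq
  have n4 := qPochInf_odd_ne_zero hq
  rw [show (p ^ 2) ^ 2 = p ^ 4 by ring] at e1 e2 n3 n4
  rw [← e1, ← e2] at *
  rw [show -1 * p = -p by ring, show p / -1 = -p by ring, show p ^ 2 / -1 = -p ^ 2 by ring, e3,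
    show -1 * p ^ 2 = -p ^ 2 by ring] at key
  have n5 := right_ne_zero_of_mul n3
  have n6 := right_ne_zero_of_mul n4
  set T := ∑' k : ℕ, (p ^ (k + 1) / (1 - (p ^ 4) ^ (k + 1)) -
        (p ^ 3) ^ (k + 1) / (1 - (p ^ 4) ^ (k + 1)))
  set A := qPochInf p (p ^ 2)
  set B := qPochInf (-p) (p ^ 2)
  set C := qPochInf (p ^ 2) (p ^ 2)
  set D := qPochInf (-p ^ 2) (p ^ 2)
  field_simp at key ⊢
  linear_combination key

/-- The cubic analogue of the two-square Lambert series, as an infinite product: the bilateral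
series at a primitive cube root of unity. -/
theorem lambert_six {p : ℂ} (hp0 : p ≠ 0) (hp : ‖p‖ < 1) :
    1 + 3 * ∑' k : ℕ, (p ^ (k + 1) / (1 - (p ^ 6) ^ (k + 1)) -
        (p ^ 5) ^ (k + 1) / (1 - (p ^ 6) ^ (k + 1))) =
      (qPochInf (p ^ 2) (p ^ 2) / qPochInf p (p ^ 2)) ^ 3 /
        (qPochInf (p ^ 6) (p ^ 6) / qPochInf (p ^ 3) (p ^ 6)) := by
  have hq := norm_sq_lt_one hp
  have hp3 : ‖p ^ 3‖ < 1 := by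
    rw [norm_pow]
    exact pow_lt_one₀ (norm_nonneg _) hp (by norm_num)
  obtain ⟨ω, hω⟩ : ∃ ω : ℂ, 1 + ω + ω ^ 2 = 0 := by
    have h := (Complex.isPrimitiveRoot_exp 3 (by norm_num)).geom_sum_eq_zero (by norm_num)
    rw [Finset.sum_range_succ, Finset.sum_range_succ, Finset.sum_range_one, pow_zero, pow_one] at h
    exact ⟨_, h⟩
  have hω3 : ω ^ 3 = 1 := by linear_combination (ω - 1) * hω
  have hω1 : ω ≠ 1 := by
    rintro rfl
    norm_num at hω
  have hω0 : ω ≠ 0 := by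
    rintro rfl
    norm_num at hω
  have hk := root_of_unity_mul_zpow_ne_one hp0 hp three_ne_zero hω3 hω1
  have key := tsum_zpow_div hp0 hp hω0 hk
  rw [tsum_zpow_div_eq hp0 hp hω0] at key
  have hw : 1 - ω ≠ 0 := sub_ne_zero.mpr hω1.symm
  have hterm : ∀ k : ℕ, p ^ (k + 1) / (1 - ω * (p ^ (k + 1)) ^ 2) +
        p ^ (k + 1) / ((p ^ (k + 1)) ^ 2 - ω) = 3 / (1 - ω) *
        (p ^ (k + 1) / (1 - (p ^ 6) ^ (k + 1)) -
        (p ^ 5) ^ (k + 1) / (1 - (p ^ 6) ^ (k + 1))) := fun k => by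
    have h4 := one_sub_pow_ne_zero hp (by omega : 6 * (k + 1) ≠ 0)
    rw [pow_right_comm p 5, pow_right_comm p 6]
    rw [mul_comm 6, pow_mul] at h4
    generalize p ^ (k + 1) = x at h4
    -- With `u = 1 - ω x²` and `v = x² - ω`: `u v = -ω (1 + x² + x⁴)`, `u + v = (1 - ω) (1 + x²)`
    -- and `(1 - ω)² = -3 ω`, whence the factor `3 / (1 - ω)`.
    have huv : (1 - ω * x ^ 2) * (x ^ 2 - ω) = -ω * (1 + x ^ 2 + x ^ 4) := by
      linear_combination x ^ 2 * hω
    have huv0 : (1 - ω * x ^ 2) * (x ^ 2 - ω) ≠ 0 := by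
      rw [huv]
      refine mul_ne_zero (neg_ne_zero.mpr hω0) fun h0 => h4 ?_
      linear_combination (1 - x ^ 2) * h0
    rw [div_add_div _ _ (left_ne_zero_of_mul huv0) (right_ne_zero_of_mul huv0), ← sub_div,
      div_mul_div_comm, div_eq_div_iff huv0 (mul_ne_zero hw h4)]
    linear_combination x * (1 - x ^ 4) * (1 - 2 * x ^ 2 + x ^ 4) * hω
  simp only [hterm] at key
  rw [tsum_mul_left] at key
  have e1 := qPochInf_mul_cube_roots hq hω p
  have e2 := qPochInf_mul_cube_roots hq hω (p ^ 2)
  have e3 := qPochInf_eq_one_sub_mul hq ω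
  have n1 := qPochInf_odd_ne_zero hp
  have n2 := qPochInf_sq_ne_zero hp
  have n3 := qPochInf_sq_ne_zero hp3
  have n4 := qPochInf_odd_ne_zero hp3
  rw [show (p ^ 3) ^ 2 = p ^ 6 by ring] at n3 n4
  rw [show (p ^ 2) ^ 3 = p ^ 6 by ring] at e1 e2
  rw [← e1, ← e2] at *
  have hinv : ∀ t : ℂ, t / ω = ω ^ 2 * t := fun t => by
    rw [div_eq_iff hω0]
    linear_combination -t * hω3
  rw [hinv, hinv, e3] at key
  have n5 := left_ne_zero_of_mul (right_ne_zero_of_mul n3)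
  have n6 := right_ne_zero_of_mul (right_ne_zero_of_mul n3)
  have n7 := left_ne_zero_of_mul (right_ne_zero_of_mul n4)
  have n8 := right_ne_zero_of_mul (right_ne_zero_of_mul n4)
  set T := ∑' k : ℕ, (p ^ (k + 1) / (1 - (p ^ 6) ^ (k + 1)) -
        (p ^ 5) ^ (k + 1) / (1 - (p ^ 6) ^ (k + 1)))
  set A := qPochInf p (p ^ 2)
  set B := qPochInf (ω * p) (p ^ 2)
  set B' := qPochInf (ω ^ 2 * p) (p ^ 2)
  set C := qPochInf (p ^ 2) (p ^ 2)
  set D := qPochInf (ω * p ^ 2) (p ^ 2)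
  set D' := qPochInf (ω ^ 2 * p ^ 2) (p ^ 2)
  field_simp at key ⊢
  linear_combination key

/-! ### Special values -/

theorem tsum_lambertTerm_eq {τ : ℂ} (hτ : 0 < τ.im) {z : ℂ} (hz : ‖qpow τ z‖ < 1) :
    ∑' i : ℕ, lambertTerm τ (z + i) =
      ∑' k : ℕ, qpow τ z ^ (k + 1) / (1 - nome τ ^ (k + 1)) := by
  rw [← tsum_geometric_swap hz (norm_nome_lt_one hτ)]
  refine tsum_congr fun i => ?_
  rw [lambertTerm, qpow_add_nat]

/-- The value at `1 / m` in base `q^m`, as a Lambert series in `q`. -/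
theorem lambertCot_one_div {σ : ℂ} (hσ : 0 < σ.im) {m : ℕ} (hm : 2 ≤ m) :
    lambertCot (m * σ) (1 / m) = ∑' k : ℕ, (nome σ ^ (k + 1) / (1 - (nome σ ^ m) ^ (k + 1)) -
      (nome σ ^ (m - 1)) ^ (k + 1) / (1 - (nome σ ^ m) ^ (k + 1))) - 1 / m + 1 / 2 := by
  have hm0 : (m : ℂ) ≠ 0 := by
    have : m ≠ 0 := by omega
    exact_mod_cast this
  have hmσ : 0 < (m * σ).im := by
    rw [← Complex.ofReal_natCast, Complex.im_ofReal_mul]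
    have : (0 : ℝ) < m := by exact_mod_cast (by omega : 0 < m)
    positivity
  have hp := norm_nome_lt_one hσ
  have h1 : qpow (m * σ) (1 / m) = nome σ := by
    rw [qpow_mul_left, mul_one_div_cancel hm0, qpow_one]
  have h2 : qpow (m * σ) (1 - 1 / m) = nome σ ^ (m - 1) := by
    rw [qpow_mul_left, ← qpow_one σ, ← qpow_nat_mul, mul_one, Nat.cast_sub (by omega), mul_sub,
      mul_one, mul_one_div_cancel hm0, Nat.cast_one]
  have h3 : nome (m * σ) = nome σ ^ m := by
    rw [← qpow_one, qpow_mul_left, qpow_nat_mul, qpow_one]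
  have hp' : ‖nome σ ^ (m - 1)‖ < 1 := by
    rw [norm_pow]
    exact pow_lt_one₀ (norm_nonneg _) hp (by omega)
  have hpm : ‖nome σ ^ m‖ < 1 := by
    rw [norm_pow]
    exact pow_lt_one₀ (norm_nonneg _) hp (by omega)
  rw [lambertCot, tsum_lambertTerm_eq hmσ (by rwa [h1]), tsum_lambertTerm_eq hmσ (by rwa [h2]), h1,
    h2, h3, ← (summable_pow_div_one_sub hp hpm).tsum_sub (summable_pow_div_one_sub hp' hpm)]

theorem lambertCot_quarter {σ : ℂ} (hσ : 0 < σ.im) :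
    lambertCot (4 * σ) (1 / 4) = 1 / 4 * (gosperPi σ ^ 2 / gosperPi (2 * σ)) := by
  have h := lambertCot_one_div hσ (m := 4) (by norm_num)
  have h4 := lambert_four (nome_ne_zero σ) (norm_nome_lt_one hσ)
  have hn : nome (2 * σ) = nome σ ^ 2 := by
    have := qpow_nat_mul σ 1 2
    rw [← qpow_mul_left] at this
    simpa only [qpow_one, Nat.cast_ofNat] using this
  have hq : qpow (2 * σ) (1 / 4) = qpow σ (1 / 4) ^ 2 := by
    rw [qpow_mul_left, ← qpow_nat_mul, Nat.cast_ofNat]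
  have hq0 := qpow_ne_zero σ (1 / 4)
  have hP : gosperPi σ ^ 2 / gosperPi (2 * σ) =
      (qPochInf (nome σ ^ 2) (nome σ ^ 2) / qPochInf (nome σ) (nome σ ^ 2)) ^ 4 /
        (qPochInf (nome σ ^ 4) (nome σ ^ 4) / qPochInf (nome σ ^ 2) (nome σ ^ 4)) ^ 2 := by
    unfold gosperPi
    rw [hn, hq, ← pow_mul]
    field_simp
  rw [hP, ← h4]
  push_cast at h
  rw [h]
  ring

theorem lambertCot_sixth {σ : ℂ} (hσ : 0 < σ.im) :
    lambertCot (6 * σ) (1 / 6) = 1 / 3 * (gosperPiSqrt σ ^ 3 / gosperPiSqrt (3 * σ)) := by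
  have h := lambertCot_one_div hσ (m := 6) (by norm_num)
  have h6 := lambert_six (nome_ne_zero σ) (norm_nome_lt_one hσ)
  have hn : nome (3 * σ) = nome σ ^ 3 := by
    have := qpow_nat_mul σ 1 3
    rw [← qpow_mul_left] at this
    simpa only [qpow_one, Nat.cast_ofNat] using this
  have hq : qpow (3 * σ) (1 / 8) = qpow σ (1 / 8) ^ 3 := by
    rw [qpow_mul_left, ← qpow_nat_mul, Nat.cast_ofNat]
  have hq0 := qpow_ne_zero σ (1 / 8)
  have hP : gosperPiSqrt σ ^ 3 / gosperPiSqrt (3 * σ) =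
      (qPochInf (nome σ ^ 2) (nome σ ^ 2) / qPochInf (nome σ) (nome σ ^ 2)) ^ 3 /
        (qPochInf (nome σ ^ 6) (nome σ ^ 6) / qPochInf (nome σ ^ 3) (nome σ ^ 6)) := by
    unfold gosperPiSqrt
    rw [hn, hq, ← pow_mul]
    field_simp
  rw [hP, ← h6]
  push_cast at h
  rw [h]
  ring

/-! ### Rational arguments -/

theorem qpow_rat_add_int_ne_one {σ : ℂ} (hσ : 0 < σ.im) {a : ℤ} {d : ℕ} (hd : 0 < d)
    (ha : ∀ n : ℤ, a + d * n ≠ 0) (n : ℤ) : qpow σ ((a : ℂ) / d + n) ≠ 1 := by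
  have hx : ((a + d * n : ℤ) : ℝ) / d ≠ 0 :=
    div_ne_zero (by exact_mod_cast ha n) (by exact_mod_cast hd.ne')
  have hd' : (d : ℂ) ≠ 0 := by exact_mod_cast hd.ne'
  have h := qpow_ofReal_ne_one hσ hx
  rw [show (a : ℂ) / d + n = (((a + d * n : ℤ) : ℝ) / d : ℝ) by push_cast; field_simp]
  exact h

theorem sum_qDigamma_sub_rat {τ : ℂ} (hτ : 0 < τ.im) {M : ℕ} (hM : 0 < M) {a : ℤ} {d : ℕ}
    (hd : 0 < d) (ha : ∀ n : ℤ, a + d * n ≠ 0) :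
    ∑ k ∈ Finset.Icc 1 M, (qDigamma τ (((d : ℂ) * k + a) / (d * M)) -
        qDigamma τ (1 - ((d : ℂ) * k + a) / (d * M))) =
      logq τ * (lambertCot (τ / M) (a / d) + a / d + 1 / 2) := by
  have hd' : (d : ℂ) ≠ 0 := by exact_mod_cast hd.ne'
  have hM' : (M : ℂ) ≠ 0 := by exact_mod_cast hM.ne'
  rw [← sum_qDigamma_sub hτ hM
    (qpow_rat_add_int_ne_one (div_natCast_im_pos hτ hM) hd ha)]
  refine Finset.sum_congr rfl fun k _ => ?_
  rw [show ((d : ℂ) * k + a) / (d * M) = (k + a / d) / M by field_simp]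

theorem qCot_rat {τ : ℂ} (hτ : 0 < τ.im) {M : ℕ} (hM : 0 < M) {a : ℤ} {d : ℕ}
    (hd : 0 < d) (ha : ∀ n : ℤ, a + d * n ≠ 0) :
    (M : ℂ) * Real.pi * qCot (τ / (2 * M)) (a * Real.pi / d) =
      -(logq τ * lambertCot (τ / M) (a / d)) := by
  have hM' : (M : ℂ) ≠ 0 := by exact_mod_cast hM.ne'
  have h2 : 2 * (τ / (2 * M)) = τ / M := by field_simp
  have him : 0 < (τ / (2 * M)).im := by
    have := div_natCast_im_pos hτ (M := 2 * M) (by omega)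
    push_cast at this
    exact this
  have h := qCot_eq him (z := (a : ℂ) / d) (by
    rw [h2]
    exact qpow_rat_add_int_ne_one (div_natCast_im_pos hτ hM) hd ha)
  have hl : logq (τ / (2 * M)) * (2 * M) = logq τ := by
    unfold logq
    field_simp
  rw [h2] at h
  rw [mul_assoc, show (a : ℂ) * Real.pi / d = a / d * Real.pi by ring, h, ← hl]
  ring

theorem lambertCot_of_modEq_one {σ : ℂ} (hσ : 0 < σ.im) {a : ℤ} {d : ℕ} (hd : 2 ≤ d)
    (ha : a ≡ 1 [ZMOD d]) : lambertCot σ (a / d) = lambertCot σ (1 / d) := by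
  obtain ⟨n, hn⟩ := ha.symm.dvd
  have hd' : (d : ℂ) ≠ 0 := by
    have : d ≠ 0 := by omega
    exact_mod_cast this
  have h := qpow_rat_add_int_ne_one hσ (a := 1) (d := d) (by omega) fun m h0 => by
    have h1 : (d : ℤ) ∣ 1 := ⟨-m, by linarith⟩
    have := Int.le_of_dvd one_pos h1
    omega
  rw [Int.cast_one] at h
  rw [← lambertCot_add_int hσ h n]
  congr 1
  have hn' : (a : ℂ) - 1 = d * n := by exact_mod_cast hn
  field_simp
  linear_combination hn'

theorem lambertCot_of_modEq_neg_one {σ : ℂ} (hσ : 0 < σ.im) {a : ℤ} {d : ℕ} (hd : 2 ≤ d)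
    (ha : a ≡ -1 [ZMOD d]) : lambertCot σ (a / d) = -lambertCot σ (1 / d) := by
  have hd' : (d : ℂ) ≠ 0 := by
    have : d ≠ 0 := by omega
    exact_mod_cast this
  have h := lambertCot_of_modEq_one hσ (a := d - a) hd (by
    rw [Int.modEq_iff_dvd] at ha ⊢
    obtain ⟨n, hn⟩ := ha
    exact ⟨-n - 1, by linarith⟩)
  rw [← h, ← lambertCot_one_sub]
  congr 1
  push_cast
  field_simp
  ring

end GosperTrig

theorem theorem2 (τ : ℂ) (hτ : 0 < τ.im) (M : ℕ) (hM : 0 < M) (a : ℤ) (ha : Odd a) :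
    -- (a)
    (∑ k ∈ Finset.Icc 1 M,
        (GosperTrig.qDigamma τ ((2 * (k : ℂ) + (a : ℂ)) / (2 * (M : ℂ))) -
          GosperTrig.qDigamma τ (1 - (2 * (k : ℂ) + (a : ℂ)) / (2 * (M : ℂ)))) =
      ((a : ℂ) + 1) / 2 * GosperTrig.logq τ) ∧
    -- (b)
    ((∑ k ∈ Finset.Icc 1 M,
        (GosperTrig.qDigamma τ ((4 * (k : ℂ) + (a : ℂ)) / (4 * (M : ℂ))) -
          GosperTrig.qDigamma τ (1 - (4 * (k : ℂ) + (a : ℂ)) / (4 * (M : ℂ)))) =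
      ((a : ℂ) + 2) * GosperTrig.logq τ / 4 -
        (M : ℂ) * (Real.pi : ℂ) *
          GosperTrig.qCot (τ / (2 * (M : ℂ))) ((a : ℂ) * (Real.pi : ℂ) / 4)) ∧
     ((a ≡ 1 [ZMOD 8] ∨ a ≡ -3 [ZMOD 8]) →
      ∑ k ∈ Finset.Icc 1 M,
        (GosperTrig.qDigamma τ ((4 * (k : ℂ) + (a : ℂ)) / (4 * (M : ℂ))) -
          GosperTrig.qDigamma τ (1 - (4 * (k : ℂ) + (a : ℂ)) / (4 * (M : ℂ)))) =
      ((a : ℂ) + 2) * GosperTrig.logq τ / 4 +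
        GosperTrig.logq τ / 4 *
          (GosperTrig.gosperPi (τ / (4 * (M : ℂ))) ^ 2 /
            GosperTrig.gosperPi (τ / (2 * (M : ℂ))))) ∧
     ((a ≡ -1 [ZMOD 8] ∨ a ≡ 3 [ZMOD 8]) →
      ∑ k ∈ Finset.Icc 1 M,
        (GosperTrig.qDigamma τ ((4 * (k : ℂ) + (a : ℂ)) / (4 * (M : ℂ))) -
          GosperTrig.qDigamma τ (1 - (4 * (k : ℂ) + (a : ℂ)) / (4 * (M : ℂ)))) =
      ((a : ℂ) + 2) * GosperTrig.logq τ / 4 -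
        GosperTrig.logq τ / 4 *
          (GosperTrig.gosperPi (τ / (4 * (M : ℂ))) ^ 2 /
            GosperTrig.gosperPi (τ / (2 * (M : ℂ)))))) ∧
    -- (c)
    ((∑ k ∈ Finset.Icc 1 M,
        (GosperTrig.qDigamma τ ((6 * (k : ℂ) + (a : ℂ)) / (6 * (M : ℂ))) -
          GosperTrig.qDigamma τ (1 - (6 * (k : ℂ) + (a : ℂ)) / (6 * (M : ℂ)))) =
      ((a : ℂ) + 3) * GosperTrig.logq τ / 6 -
        (M : ℂ) * (Real.pi : ℂ) *
          GosperTrig.qCot (τ / (2 * (M : ℂ))) ((a : ℂ) * (Real.pi : ℂ) / 6)) ∧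
     ((a ≡ 1 [ZMOD 12] ∨ a ≡ -5 [ZMOD 12]) →
      ∑ k ∈ Finset.Icc 1 M,
        (GosperTrig.qDigamma τ ((6 * (k : ℂ) + (a : ℂ)) / (6 * (M : ℂ))) -
          GosperTrig.qDigamma τ (1 - (6 * (k : ℂ) + (a : ℂ)) / (6 * (M : ℂ)))) =
      ((a : ℂ) + 3) * GosperTrig.logq τ / 6 +
        GosperTrig.logq τ / 3 *
          (GosperTrig.gosperPiSqrt (τ / (6 * (M : ℂ))) ^ 3 /
            GosperTrig.gosperPiSqrt (τ / (2 * (M : ℂ))))) ∧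
     ((a ≡ -1 [ZMOD 12] ∨ a ≡ 5 [ZMOD 12]) →
      ∑ k ∈ Finset.Icc 1 M,
        (GosperTrig.qDigamma τ ((6 * (k : ℂ) + (a : ℂ)) / (6 * (M : ℂ))) -
          GosperTrig.qDigamma τ (1 - (6 * (k : ℂ) + (a : ℂ)) / (6 * (M : ℂ)))) =
      ((a : ℂ) + 3) * GosperTrig.logq τ / 6 -
        GosperTrig.logq τ / 3 *
          (GosperTrig.gosperPiSqrt (τ / (6 * (M : ℂ))) ^ 3 /
            GosperTrig.gosperPiSqrt (τ / (2 * (M : ℂ)))))) := by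
  have hσ := GosperTrig.div_natCast_im_pos hτ hM
  have hM' : (M : ℂ) ≠ 0 := by exact_mod_cast hM.ne'
  obtain ⟨m, hm⟩ := ha
  have s2 := GosperTrig.sum_qDigamma_sub_rat hτ hM (a := a) (d := 2) (by norm_num)
    (fun n => by omega)
  have s4 := GosperTrig.sum_qDigamma_sub_rat hτ hM (a := a) (d := 4) (by norm_num)
    (fun n => by omega)
  have s6 := GosperTrig.sum_qDigamma_sub_rat hτ hM (a := a) (d := 6) (by norm_num)
    (fun n => by omega)
  have c4 := GosperTrig.qCot_rat hτ hM (a := a) (d := 4) (by norm_num) (fun n => by omega)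
  have c6 := GosperTrig.qCot_rat hτ hM (a := a) (d := 6) (by norm_num) (fun n => by omega)
  have v4 := GosperTrig.lambertCot_quarter (σ := τ / (4 * M)) (by
    have := GosperTrig.div_natCast_im_pos hτ (M := 4 * M) (by omega)
    push_cast at this
    exact this)
  have v6 := GosperTrig.lambertCot_sixth (σ := τ / (6 * M)) (by
    have := GosperTrig.div_natCast_im_pos hτ (M := 6 * M) (by omega)
    push_cast at this
    exact this)
  rw [show 4 * (τ / (4 * M)) = τ / M by field_simp,
    show 2 * (τ / (4 * M)) = τ / (2 * M) by field_simp; ring] at v4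
  rw [show 6 * (τ / (6 * M)) = τ / M by field_simp,
    show 3 * (τ / (6 * M)) = τ / (2 * M) by field_simp; ring] at v6
  -- `lambertCot` is odd about `1 / 2`, hence vanishes there.
  have v2 : GosperTrig.lambertCot (τ / M) (1 / 2) = 0 := by
    have h := GosperTrig.lambertCot_one_sub (τ / M) (1 / 2)
    rw [show (1 : ℂ) - 1 / 2 = 1 / 2 by norm_num] at h
    linear_combination h / 2
  push_cast at s2 s4 s6 c4 c6
  rw [s2, s4, s6, c4, c6]
  refine ⟨?_, ⟨?_, fun h => ?_, fun h => ?_⟩, ?_, fun h => ?_, fun h => ?_⟩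
  · have h := GosperTrig.lambertCot_of_modEq_one hσ (a := a) (d := 2) le_rfl
      (by rw [Int.ModEq]; omega)
    push_cast at h
    rw [h, v2]
    ring
  · ring
  · have h := GosperTrig.lambertCot_of_modEq_one hσ (a := a) (d := 4) (by norm_num)
      (by simp only [Int.ModEq] at h ⊢; omega)
    push_cast at h
    rw [h, v4]
    ring
  · have h := GosperTrig.lambertCot_of_modEq_neg_one hσ (a := a) (d := 4) (by norm_num)
      (by simp only [Int.ModEq] at h ⊢; omega)
    push_cast at h
    rw [h, v4]
    ring
  · ring
  · have h := GosperTrig.lambertCot_of_modEq_one hσ (a := a) (d := 6) (by norm_num)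
      (by simp only [Int.ModEq] at h ⊢; omega)
    push_cast at h
    rw [h, v6]
    ring
  · have h := GosperTrig.lambertCot_of_modEq_neg_one hσ (a := a) (d := 6) (by norm_num)
      (by simp only [Int.ModEq] at h ⊢; omega)
    push_cast at h
    rw [h, v6]
    ring
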